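/- Let $A:\operatorname{dom}(A)\subseteq\mathcal H\to\mathcal H$ be a (possibly unbounded) selfadjoint operator in a complex Hilbert space $\mathcal H$ with spectrum $\Sigma(A)\subset\mathbb R$ and resolvent $R(z)=(z-A)^{-1}$. Let $\Lambda\subset\Sigma(A)$ be a nonempty finite set of eigenvalues of finite multiplicity, let $E$ be the span of all eigenvectors of $A$ with eigenvalue in $\Lambda$, so that $m=\dim E$ satisfies $1\le m<\infty$, and let $S$ be the $\mathcal H$-orthogonal projection onto $E$. Let $$r_N(\xi)=w_N+\sum_{k=0}^{N-1}w_k(z_k-\xi)^{-1},\qquad w_k,z_k\in\mathbb C,$$ and assume the following. (1) There are $y\in\mathbb R$, $\delta>0$, $\gamma>0$ such that, with $I=\{x\in\mathbb R:|x-y|\le\gamma\}$ and $O=\{x\in\mathbb R:|x-y|\ge(1+\delta)\gamma\}$, one has $\Lambda\subset I$, $\Sigma(A)\setminus\Lambda\subset O$, $z_k\notin\overline{\Sigma(A)}$ for all $k$, $\inf_{I}|r_N|>0$ and $\hat\kappa=\sup_{O}|r_N|\,/\,\inf_{I}|r_N|<1$ (supremum and infimum over the points of $O$ and $I$ at which the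 formula for $r_N$ is defined). (2) $\mathcal V\subseteq\mathcal H$ is a Hilbert space with $E\subseteq\mathcal V$ and $\|u\|_{\mathcal H}\le C_{\mathcal V}\|u\|_{\mathcal V}$ for all $u\in\mathcal V$ and some $C_{\mathcal V}>0$, and $R(z)\mathcal V\subseteq\mathcal V$ for all $z\notin\Sigma(A)$. (3) For each value $h>0$ of a discretization parameter, $\mathcal V_h\subseteq\mathcal V$ is a finite-dimensional subspace and the $R_h(z_k):\mathcal H\to\mathcal V_h$ are linear operators such that $R_h(z_k)$ and $R(z_k)$ are bounded on $\mathcal V$ and $\lim_{h\to0}\|R_h(z_k)-R(z_k)\|_{\mathcal V}=0$ for $k=0,\dots,N-1$. (4) $\mathcal V_h\subseteq\operatorname{dom}(a)$ for each $h$. Here $A=U_A|A|=|A|U_A$ is the polar decomposition, $\operatorname{dom}(a)=\operatorname{dom}(|A|^{1/2})$ and $a(x,y)=(U_A|A|^{1/2}x,|A|^{1/2}y)_{\mathcal H}$ for $x,y\in\operatorname{dom}(a)$. View $S_N=w_N+\sum_k w_kR(z_k)$ and $S_N^h=w_N+\sum_k w_kR_h(z_k)$ as bounded operators on $\mathcal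 V$. Let $\Theta$ be a positively oriented simple closed rectifiable curve in $\mathbb C$ that encloses $M=\{r_N(\lambda):\lambda\in\Lambda\}$, encloses no other point of the spectrum $\Sigma(S_N)$, and lies strictly outside the circle about $0$ of radius $\mu_*=\sup\{|\mu|:\mu\in\Sigma(S_N)\setminus M\}$ ($\mu_*=0$ if this set is empty). Put $$P_h=\frac1{2\pi\mathrm i}\oint_\Theta(z-S_N^h)^{-1}\,dz,\qquad E_h=\operatorname{ran}P_h .$$ For a finite-dimensional $F\subseteq\operatorname{dom}(a)$ let $A_F:F\to F$ be given by $(A_Fx,y)_{\mathcal H}=a(x,y)$ for $x,y\in F$, and let $\|A_F\|$ be its operator norm for the $\mathcal H$-norm on $F$. Let $Q_h$ be the $\mathcal H$-orthogonal projection onto $E_h$, let $|u|_a=|a(u,u)|^{1/2}$, $$|(S-I)Q_h|_{a,E_h}=\sup_{0\ne v\in E_h}\frac{|(S-I)Q_hv|_a}{\|v\|_{\mathcal H}},\qquad \operatorname{gap}_{\mathcal H}(E,E_h)=\max\Big[\sup_{e\in E,\,\|e\|_{\mathcal H}=1}\operatorname{dist}_{\mathcal H}(e,E_h),\ \sup_{e\in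 E_h,\,\|e\|_{\mathcal H}=1}\operatorname{dist}_{\mathcal H}(e,E)\Big],$$ let $\Lambda_h=\Sigma(A_{E_h})$ be the set of Ritz values of $A$ on $E_h$, and let $\operatorname{dist}(\Lambda,\Lambda_h)$ be the Hausdorff distance. Then there are constants $C_0>0$ and $h_0>0$ such that for all $h<h_0$ the curve $\Theta$ lies in the resolvent set of $S_N^h$, $\dim E_h=m$, $E_h\subseteq\operatorname{dom}(a)$ (so that all quantities above are well defined), and $$\operatorname{dist}(\Lambda,\Lambda_h)\le|(S-I)Q_h|_{a,E_h}^2+C_0\,\|A_E\|\,\operatorname{gap}_{\mathcal H}(E,E_h)^2 .$$ -/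

import Mathlib

open Filter Topology

noncomputable section

namespace FilteredSubspace

open Classical in
/-- Orthogonal projection onto a subspace `F` of a Hilbert space, as an operator on the whole
space (every closed, in particular every finite-dimensional, subspace has one). -/
def orthProj {H : Type*} [NormedAddCommGroup H] [InnerProductSpace ℂ H]
    (F : Submodule ℂ H) : H →L[ℂ] H :=
  if h : F.HasOrthogonalProjection then @Submodule.starProjection ℂ H _ _ _ F h else 0

/-- The gap between two subspaces of a normed space. -/
def gap {X : Type*} [NormedAddCommGroup X] [NormedSpace ℂ X] (M L : Submodule ℂ X) : ℝ :=
  max (⨆ m : {m : X // m ∈ M ∧ ‖m‖ = 1}, Metric.infDist (m : X) (L : Set X))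
    (⨆ l : {l : X // l ∈ L ∧ ‖l‖ = 1}, Metric.infDist (l : X) (M : Set X))

section Operators

variable {H : Type*} [NormedAddCommGroup H] [InnerProductSpace ℂ H]

/-! ### Spectrum and resolvent of an unbounded operator -/

/-- `T` is a bounded two-sided inverse of `z - A : dom A → H`. -/
def IsResolventAt (A : H →ₗ.[ℂ] H) (z : ℂ) (T : H →L[ℂ] H) : Prop :=
  (∀ x : H, ∃ hx : T x ∈ A.domain, z • T x - A ⟨T x, hx⟩ = x) ∧
    ∀ x : A.domain, T (z • (x : H) - A x) = x

/-- The spectrum of `A`: the complement of the resolvent set. -/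
def opSpectrum (A : H →ₗ.[ℂ] H) : Set ℂ := {z | ¬ ∃ T, IsResolventAt A z T}

open Classical in
/-- The resolvent `R(z) = (z - A)⁻¹`. -/
def opResolvent (A : H →ₗ.[ℂ] H) (z : ℂ) : H →L[ℂ] H :=
  if h : ∃ T, IsResolventAt A z T then h.choose else 0

/-! ### The cluster of eigenvalues and its eigenspace -/

/-- The span of all eigenvectors of `A` with eigenvalue in `Λ`. -/
def eigenspaceOf (A : H →ₗ.[ℂ] H) (Λ : Finset ℝ) : Submodule ℂ H :=
  Submodule.span ℂ {x | ∃ l ∈ Λ, ∃ hx : x ∈ A.domain, A ⟨x, hx⟩ = (l : ℂ) • x}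

/-- `Λ` is a non-empty finite set of eigenvalues of `A` of finite multiplicity. -/
structure IsCluster (A : H →ₗ.[ℂ] H) (Λ : Finset ℝ) : Prop where
  nonempty : Λ.Nonempty
  eigenvalue : ∀ l ∈ Λ, ∃ x : A.domain, x ≠ 0 ∧ A x = (l : ℂ) • (x : H)
  finite : FiniteDimensional ℂ (eigenspaceOf A Λ)

/-! ### Polar decomposition, square root, and the form associated to `A` -/

/-- A positive semidefinite selfadjoint operator. -/
structure IsPosSelfAdjoint [CompleteSpace H] (P : H →ₗ.[ℂ] H) : Prop where
  selfAdjoint : IsSelfAdjoint P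
  nonneg : ∀ x : P.domain, 0 ≤ (inner ℂ (x : H) (P x)).re

/-- `A = U P = P U` (equality of operators, domains included) is the polar decomposition of the
selfadjoint operator `A`: `P = |A|` is selfadjoint and positive semidefinite, and `U` is a
selfadjoint partial isometry with the same kernel as `P`. Every selfadjoint operator has exactly
one polar decomposition. -/
structure IsPolarDecomposition [CompleteSpace H] (A : H →ₗ.[ℂ] H) (U : H →L[ℂ] H)
    (P : H →ₗ.[ℂ] H) : Prop where
  pos : IsPosSelfAdjoint P
  selfAdjoint : IsSelfAdjoint U
  partialIsometry : U * star U * U = U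
  ker : ∀ x : H, U x = 0 ↔ (x, (0 : H)) ∈ P.graph
  eq_left : ∀ x y : H, (x, y) ∈ A.graph ↔ ∃ w, (x, w) ∈ P.graph ∧ y = U w
  eq_right : ∀ x y : H, (x, y) ∈ A.graph ↔ (U x, y) ∈ P.graph

/-- `B` is the positive semidefinite selfadjoint square root of `P`: `B ∘ B = P`.
Every positive semidefinite selfadjoint operator has exactly one. -/
structure IsPosSqrt [CompleteSpace H] (P B : H →ₗ.[ℂ] H) : Prop where
  pos : IsPosSelfAdjoint B
  sq : ∀ x y : H, (x, y) ∈ P.graph ↔ ∃ w, (x, w) ∈ B.graph ∧ (w, y) ∈ B.graph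

open Classical in
/-- The factor `|A|` of the polar decomposition. -/
def absOp [CompleteSpace H] (A : H →ₗ.[ℂ] H) : H →ₗ.[ℂ] H :=
  if h : ∃ P, ∃ U, IsPolarDecomposition A U P then h.choose else ⊥

open Classical in
/-- The factor `U_A` of the polar decomposition. -/
def polarU [CompleteSpace H] (A : H →ₗ.[ℂ] H) : H →L[ℂ] H :=
  if h : ∃ U, IsPolarDecomposition A U (absOp A) then h.choose else 0

open Classical in
/-- The positive square root of a positive selfadjoint operator. -/
def posSqrt [CompleteSpace H] (P : H →ₗ.[ℂ] H) : H →ₗ.[ℂ] H :=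
  if h : ∃ B, IsPosSqrt P B then h.choose else ⊥

/-- `|A|^{1/2}`. -/
def absSqrt [CompleteSpace H] (A : H →ₗ.[ℂ] H) : H →ₗ.[ℂ] H := posSqrt (absOp A)

/-- `dom(a) = dom(|A|^{1/2})`. -/
def formDomain [CompleteSpace H] (A : H →ₗ.[ℂ] H) : Submodule ℂ H := (absSqrt A).domain

open Classical in
/-- The form `a(x, y) = (U_A |A|^{1/2} x, |A|^{1/2} y)` on `dom(a)`, linear in `x`
(extended by `0` outside `dom(a)`). -/
def form [CompleteSpace H] (A : H →ₗ.[ℂ] H) (x y : H) : ℂ :=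
  if h : x ∈ formDomain A ∧ y ∈ formDomain A then
    inner ℂ (absSqrt A ⟨y, h.2⟩) (polarU A (absSqrt A ⟨x, h.1⟩))
  else 0

/-- `|u|_a = |a(u, u)|^{1/2}`. -/
def formSeminorm [CompleteSpace H] (A : H →ₗ.[ℂ] H) (u : H) : ℝ := Real.sqrt ‖form A u u‖

/-- `T : F → F` satisfies `(T x, y) = a(x, y)` for all `x, y ∈ F`. -/
def IsRitzOp [CompleteSpace H] (A : H →ₗ.[ℂ] H) (F : Submodule ℂ H) (T : F →L[ℂ] F) : Prop :=
  ∀ x y : F, inner ℂ (y : H) (T x : H) = form A x y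

open Classical in
/-- The operator `A_F : F → F` for a finite-dimensional `F ⊆ dom(a)`. -/
def ritzOp [CompleteSpace H] (A : H →ₗ.[ℂ] H) (F : Submodule ℂ H) : F →L[ℂ] F :=
  if h : ∃ T, IsRitzOp A F T then h.choose else 0

/-- The Ritz values of `A` on `F`. -/
def ritzValues [CompleteSpace H] (A : H →ₗ.[ℂ] H) (F : Submodule ℂ H) : Set ℂ :=
  spectrum ℂ (ritzOp A F)

/-- `|(S - I) Q|_{a, F}`, where `S`, `Q` are the orthogonal projections onto `E`, `F`. -/
def projSeminorm [CompleteSpace H] (A : H →ₗ.[ℂ] H) (E F : Submodule ℂ H) : ℝ :=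
  ⨆ v : {v : H // v ∈ F ∧ v ≠ 0},
    formSeminorm A ((orthProj E - ContinuousLinearMap.id ℂ H) (orthProj F (v : H))) / ‖(v : H)‖

end Operators

/-! ### The rational filter -/

/-- `r_N(ξ) = w_N + ∑_{k < N} w_k (z_k - ξ)⁻¹`; the constant term `w_N` is called `c`. -/
def ratFilter {N : ℕ} (c : ℂ) (w z : Fin N → ℂ) (ξ : ℂ) : ℂ :=
  c + ∑ k, w k * (z k - ξ)⁻¹

/-- The interval `|x - y| ≤ γ`. -/
def innerSet (y γ : ℝ) : Set ℝ := {x | |x - y| ≤ γ}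

/-- The set `|x - y| ≥ (1 + δ) γ`. -/
def outerSet (y δ γ : ℝ) : Set ℝ := {x | (1 + δ) * γ ≤ |x - y|}

/-- The supremum of `|r_N|` over the outer set. The finitely many points `z_k`, where the formula
for `r_N` divides by zero, are left out; a pole in the outer set still makes this `∞`. -/
def filterSup {N : ℕ} (c : ℂ) (w z : Fin N → ℂ) (y δ γ : ℝ) : ENNReal :=
  ⨆ x ∈ {x : ℝ | x ∈ outerSet y δ γ ∧ ∀ k, z k ≠ x}, ‖ratFilter c w z (x : ℂ)‖ₑ

/-- The infimum of `|r_N|` over the inner interval (points `z_k` left out as above). -/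
def filterInf {N : ℕ} (c : ℂ) (w z : Fin N → ℂ) (y γ : ℝ) : ENNReal :=
  ⨅ x ∈ {x : ℝ | x ∈ innerSet y γ ∧ ∀ k, z k ≠ x}, ‖ratFilter c w z (x : ℂ)‖ₑ

/-- The contraction factor. -/
def kappaHat {N : ℕ} (c : ℂ) (w z : Fin N → ℂ) (y δ γ : ℝ) : ENNReal :=
  filterSup c w z y δ γ / filterInf c w z y γ

section Discretization

variable {H V : Type*} [NormedAddCommGroup H] [InnerProductSpace ℂ H]
  [NormedAddCommGroup V] [InnerProductSpace ℂ V]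

/-- Separation of the cluster and dominance of the filter. The denominator of the contraction
factor must not vanish, so that the quotient makes sense. -/
def FilterAssumption (A : H →ₗ.[ℂ] H) (Λ : Finset ℝ) {N : ℕ} (c : ℂ) (w z : Fin N → ℂ) : Prop :=
  ∃ y δ γ : ℝ, 0 < δ ∧ 0 < γ ∧
    (Λ : Set ℝ) ⊆ innerSet y γ ∧
    opSpectrum A \ (Complex.ofReal '' (Λ : Set ℝ)) ⊆ Complex.ofReal '' outerSet y δ γ ∧
    (∀ k, z k ∉ closure (opSpectrum A)) ∧
    filterInf c w z y γ ≠ 0 ∧ kappaHat c w z y δ γ < 1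

/-- The Hilbert space `V`, embedded in `H` by the bounded injective map `i`, contains `E` and is
invariant under the resolvent. -/
structure EmbeddingAssumption (A : H →ₗ.[ℂ] H) (Λ : Finset ℝ) (i : V →L[ℂ] H) : Prop where
  injective : Function.Injective i
  contains : eigenspaceOf A Λ ≤ LinearMap.range (i : V →ₗ[ℂ] H)
  invariant : ∀ ζ ∉ opSpectrum A, ∀ v : V,
    opResolvent A ζ (i v) ∈ LinearMap.range (i : V →ₗ[ℂ] H)

/-- `T` is the restriction of the operator `R` on `H` to a bounded operator on `V`. -/
def IsRestriction (i : V →L[ℂ] H) (R : H →ₗ[ℂ] H) (T : V →L[ℂ] V) : Prop :=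
  ∀ v, i (T v) = R (i v)

open Classical in
/-- An operator on `H` that maps `V` boundedly into itself, viewed as an operator on `V`. -/
def restrictV (i : V →L[ℂ] H) (R : H →ₗ[ℂ] H) : V →L[ℂ] V :=
  if h : ∃ T, IsRestriction i R T then h.choose else 0

/-- The discrete resolvents `Rh h ζ : H → V_h`, for parameters `h` in the set `I`: the spaces
`V_h ⊆ V` are finite-dimensional, `R_h(z_k)` and `R(z_k)` are bounded on `V`, and
`‖R_h(z_k) - R(z_k)‖_V → 0` as `h → 0`. -/
structure DiscretizationAssumption (A : H →ₗ.[ℂ] H) {N : ℕ} (z : Fin N → ℂ) (i : V →L[ℂ] H)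
    (I : Set ℝ) (Vh : ℝ → Submodule ℂ H) (Rh : ℝ → ℂ → H →ₗ[ℂ] H) : Prop where
  finite : ∀ h ∈ I, FiniteDimensional ℂ (Vh h)
  subspace : ∀ h ∈ I, Vh h ≤ LinearMap.range (i : V →ₗ[ℂ] H)
  range : ∀ h ∈ I, ∀ k x, Rh h (z k) x ∈ Vh h
  bounded_discrete : ∀ h ∈ I, ∀ k, ∃ T, IsRestriction i (Rh h (z k)) T
  bounded : ∀ k, ∃ T, IsRestriction i (opResolvent A (z k) : H →ₗ[ℂ] H) T
  limit : ∀ k, Tendsto (fun h => ‖restrictV i (Rh h (z k)) -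
    restrictV i (opResolvent A (z k) : H →ₗ[ℂ] H)‖) (𝓝[I] 0) (𝓝 0)

/-- The filter `S_N = w_N + ∑ w_k R(z_k)` as an operator on `V`. -/
def filterOp (A : H →ₗ.[ℂ] H) {N : ℕ} (c : ℂ) (w z : Fin N → ℂ) (i : V →L[ℂ] H) : V →L[ℂ] V :=
  c • ContinuousLinearMap.id ℂ V +
    ∑ k, w k • restrictV i (opResolvent A (z k) : H →ₗ[ℂ] H)

/-- The discrete filter `S_N^h = w_N + ∑ w_k R_h(z_k)` as an operator on `V`; here `R` is the
map `ζ ↦ R_h(ζ)`. -/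
def discreteFilterOp {N : ℕ} (c : ℂ) (w z : Fin N → ℂ) (i : V →L[ℂ] H)
    (R : ℂ → H →ₗ[ℂ] H) : V →L[ℂ] V :=
  c • ContinuousLinearMap.id ℂ V + ∑ k, w k • restrictV i (R (z k))

end Discretization

/-! ### Contours and spectral projectors -/

/-- A simple closed rectifiable curve, parametrized on `[0, 1]` by a Lipschitz map (every
rectifiable curve has such a parametrization, e.g. a multiple of arc length). -/
structure IsSimpleClosedCurve (θ : ℝ → ℂ) : Prop where
  lipschitz : ∃ K, LipschitzOnWith K θ (Set.Icc 0 1)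
  closed : θ 0 = θ 1
  simple : Set.InjOn θ (Set.Ico 0 1)

/-- `(2πi)⁻¹ ∮_θ f(z) dz`. -/
def contourMean {X : Type*} [NormedAddCommGroup X] [NormedSpace ℂ X] (θ : ℝ → ℂ) (f : ℂ → X) : X :=
  (2 * (Real.pi : ℂ) * Complex.I)⁻¹ • ∫ t in (0 : ℝ)..1, deriv θ t • f (θ t)

/-- The curve has winding number `n` around the point `ζ` off the curve. A positively oriented
simple closed curve encloses the points with winding number `1`, and the points outside it are
those with winding number `0`. -/
def HasWinding (θ : ℝ → ℂ) (ζ : ℂ) (n : ℤ) : Prop :=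
  (∀ t ∈ Set.Icc (0 : ℝ) 1, θ t ≠ ζ) ∧ contourMean θ (fun z => (z - ζ)⁻¹) = n

/-- `θ` is a simple closed rectifiable curve that encloses the set `M`, encloses no other point of
the spectrum of `T`, and lies strictly outside the circle of radius
`sup {|μ| : μ ∈ spectrum T \ M}` (read as `0` if there is no such `μ`). -/
structure IsSeparatingContour {V : Type*} [NormedAddCommGroup V] [NormedSpace ℂ V]
    (T : V →L[ℂ] V) (M : Set ℂ) (θ : ℝ → ℂ) : Prop where
  curve : IsSimpleClosedCurve θ
  encloses : ∀ μ ∈ M, HasWinding θ μ 1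
  excludes : ∀ μ ∈ spectrum ℂ T \ M, HasWinding θ μ 0
  outside : ∀ t ∈ Set.Icc (0 : ℝ) 1, sSup ((fun μ : ℂ => ‖μ‖) '' (spectrum ℂ T \ M)) < ‖θ t‖

/-- The spectral projector `(2πi)⁻¹ ∮_θ (z - T)⁻¹ dz`. -/
def spectralProjector {V : Type*} [NormedAddCommGroup V] [NormedSpace ℂ V]
    (T : V →L[ℂ] V) (θ : ℝ → ℂ) : V →L[ℂ] V :=
  contourMean θ (fun z => resolvent T z)

/-- The limit space `E_h`: the range of the spectral projector of `T = S_N^h`, as a subspace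
of `H`. -/
def limitSpace {H V : Type*} [NormedAddCommGroup H] [InnerProductSpace ℂ H]
    [NormedAddCommGroup V] [InnerProductSpace ℂ V] (i : V →L[ℂ] H) (T : V →L[ℂ] V)
    (θ : ℝ → ℂ) : Submodule ℂ H :=
  (LinearMap.range (spectralProjector T θ : V →ₗ[ℂ] V)).map (i : V →ₗ[ℂ] H)

end FilteredSubspace

end

/-! Write `p` for the orthogonal projection `S` restricted to `V` and `q` for the discrete spectral
projector `P_h`. The proof identifies the exact projector with `p`, perturbs it to `q`, and ends
with an exact identity for the Ritz operator in finite dimensions.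

The Riesz integral of `S_N` over the contour equals `p` (`rieszIntegral_filterOp`). On eigenvectors
the resolvent is a scalar Cauchy kernel, so the integral acts as the winding number `1`. On the
complement of `p` the enclosed points `r_N(λ)` must be shown to be regular. There `S_N - μ` is a
rational function of one reduced resolvent, whose nonzero spectrum comes only from the spectrum of
`A` outside the cluster (`EmbeddingAssumption.spectrum_reduced`), and `|r_N|` is strictly smaller on
that set. Removing the cluster uses normality on `H`, where isolated spectral points are
eigenvalues, and an intertwining argument carries the result to `V`. Contour deformation is replaced
by a Dixon-type argument (`eq_zero_of_winding`): Cauchy integrals of the resolvent continue suitable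
products across the spectrum to entire functions that vanish at infinity.

Norm convergence of the filters gives `‖p - q‖ < 1` for small `h`, hence equal ranks and injectivity
of `S` on `E_h` (`exists_forall_limitSpace`). The value `c = w_N` is never enclosed as a spectral
point, so `q` factors through `S_N^h - c`, whose values lie in `V_h`. This puts `E_h` in the form
domain.

On `E_h` the form splits without cross terms into the part seen through `S` and the part on `(S -
I)Q`, so that `A_{E_h} = Q A_E S + K` with `‖K‖ ≤ |(S - I)Q|²`. Since `I - QS` on `E_h` and `I - SQ`
on `E` are of second order in the gap, residual bounds for symmetric operators give both halves of
the Hausdorff estimate (`hausdorffDist_ritzValues_le`), with `C₀ = 1`.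

The chosen `|A|`, `U_A` and `|A|^{1/2}` need not be constructed: their default value has trivial
domain, whereas the form domain contains the nonzero space `E_h`
(`isPolarDecomposition_of_formDomain_ne_bot`). -/

noncomputable section

namespace FilteredSubspace

/-! ### Integrals along Lipschitz curves -/

section Contour

variable {θ : ℝ → ℂ} {K : NNReal}

/-- The trace of a curve parametrized on `[0, 1]`. -/
def curveTrace (θ : ℝ → ℂ) : Set ℂ := θ '' Set.Icc 0 1

theorem isCompact_curveTrace (hθ : LipschitzOnWith K θ (Set.Icc 0 1)) :
    IsCompact (curveTrace θ) :=
  isCompact_Icc.image_of_continuousOn hθ.continuousOn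

theorem mem_curveTrace {t : ℝ} (ht : t ∈ Set.Icc (0 : ℝ) 1) : θ t ∈ curveTrace θ :=
  ⟨t, ht, rfl⟩

theorem norm_deriv_le_on_Ioo (hθ : LipschitzOnWith K θ (Set.Icc 0 1)) {t : ℝ}
    (ht : t ∈ Set.Ioo (0 : ℝ) 1) : ‖deriv θ t‖ ≤ K :=
  norm_deriv_le_of_lipschitzOn (Icc_mem_nhds ht.1 ht.2) hθ

/-- The Lipschitz bound controls `deriv θ` only where `[0, 1]` is a neighbourhood; the remaining end
point is a null set. -/
theorem ae_mem_Ioo_of_mem_uIoc :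
    ∀ᵐ t : ℝ, t ∈ Set.uIoc (0 : ℝ) 1 → t ∈ Set.Ioo (0 : ℝ) 1 := by
  have h : ∀ᵐ t : ℝ, t ≠ 1 := by simp [MeasureTheory.ae_iff]
  filter_upwards [h] with t ht ht'
  rw [Set.uIoc_of_le zero_le_one] at ht'
  exact ⟨ht'.1, lt_of_le_of_ne ht'.2 ht⟩

variable {X : Type*} [NormedAddCommGroup X] [NormedSpace ℂ X]

theorem aestronglyMeasurable_contour (hθ : LipschitzOnWith K θ (Set.Icc 0 1)) {f : ℂ → X}
    (hf : ContinuousOn f (curveTrace θ)) :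
    MeasureTheory.AEStronglyMeasurable (fun t => deriv θ t • f (θ t))
      (MeasureTheory.volume.restrict (Set.uIoc (0 : ℝ) 1)) := by
  refine (aestronglyMeasurable_deriv θ _).smul ?_
  have hc : ContinuousOn (fun t => f (θ t)) (Set.Icc 0 1) :=
    hf.comp hθ.continuousOn fun t ht => mem_curveTrace ht
  have := hc.aestronglyMeasurable (μ := MeasureTheory.volume) measurableSet_Icc
  rw [Set.uIoc_of_le zero_le_one]
  exact this.mono_set Set.Ioc_subset_Icc_self

theorem intervalIntegrable_contour (hθ : LipschitzOnWith K θ (Set.Icc 0 1)) {f : ℂ → X}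
    (hf : ContinuousOn f (curveTrace θ)) :
    IntervalIntegrable (fun t => deriv θ t • f (θ t)) MeasureTheory.volume 0 1 := by
  obtain ⟨C, hC⟩ := (isCompact_curveTrace hθ).exists_bound_of_continuousOn hf
  refine (intervalIntegrable_const (c := (K : ℝ) * C)).mono_fun
    (aestronglyMeasurable_contour hθ hf) ?_
  rw [Filter.EventuallyLE, MeasureTheory.ae_restrict_iff' measurableSet_uIoc]
  filter_upwards [ae_mem_Ioo_of_mem_uIoc] with t ht ht'
  have h1 := norm_deriv_le_on_Ioo hθ (ht ht')
  have h2 := hC _ (mem_curveTrace (Set.Ioo_subset_Icc_self (ht ht')))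
  rw [norm_smul]
  calc ‖deriv θ t‖ * ‖f (θ t)‖ ≤ K * C := by gcongr
    _ ≤ ‖(K : ℝ) * C‖ := le_abs_self _

theorem contourMean_congr {f g : ℂ → X} (h : Set.EqOn f g (curveTrace θ)) :
    contourMean θ f = contourMean θ g := by
  unfold contourMean
  congr 1
  refine intervalIntegral.integral_congr fun t ht => ?_
  rw [Set.uIcc_of_le zero_le_one] at ht
  simp only [h (mem_curveTrace ht)]

theorem contourMean_sub (hθ : LipschitzOnWith K θ (Set.Icc 0 1)) {f g : ℂ → X}
    (hf : ContinuousOn f (curveTrace θ)) (hg : ContinuousOn g (curveTrace θ)) :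
    contourMean θ (fun z => f z - g z) = contourMean θ f - contourMean θ g := by
  unfold contourMean
  rw [← smul_sub, ← intervalIntegral.integral_sub (intervalIntegrable_contour hθ hf)
    (intervalIntegrable_contour hθ hg)]
  simp only [smul_sub]

theorem contourMean_add (hθ : LipschitzOnWith K θ (Set.Icc 0 1)) {f g : ℂ → X}
    (hf : ContinuousOn f (curveTrace θ)) (hg : ContinuousOn g (curveTrace θ)) :
    contourMean θ (fun z => f z + g z) = contourMean θ f + contourMean θ g := by
  unfold contourMean
  rw [← smul_add, ← intervalIntegral.integral_add (intervalIntegrable_contour hθ hf)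
    (intervalIntegrable_contour hθ hg)]
  simp only [smul_add]

theorem contourMean_clm [CompleteSpace X] {Y : Type*} [NormedAddCommGroup Y] [NormedSpace ℂ Y]
    [CompleteSpace Y] (hθ : LipschitzOnWith K θ (Set.Icc 0 1)) (L : X →L[ℂ] Y) {f : ℂ → X}
    (hf : ContinuousOn f (curveTrace θ)) :
    contourMean θ (fun z => L (f z)) = L (contourMean θ f) := by
  unfold contourMean
  rw [map_smul, ← ContinuousLinearMap.intervalIntegral_comp_comm L
    (intervalIntegrable_contour hθ hf)]
  simp only [map_smul]

theorem norm_contourMean_le (hθ : LipschitzOnWith K θ (Set.Icc 0 1)) {f : ℂ → X} {C : ℝ}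
    (hf : ∀ z ∈ curveTrace θ, ‖f z‖ ≤ C) : ‖contourMean θ f‖ ≤ K * C := by
  have hC : 0 ≤ C := (norm_nonneg _).trans
    (hf _ (mem_curveTrace (Set.left_mem_Icc.2 zero_le_one)))
  have h : ‖∫ t in (0 : ℝ)..1, deriv θ t • f (θ t)‖ ≤ K * C * |(1 : ℝ) - 0| := by
    refine intervalIntegral.norm_integral_le_of_norm_le_const_ae ?_
    filter_upwards [ae_mem_Ioo_of_mem_uIoc] with t ht ht'
    have h1 := norm_deriv_le_on_Ioo hθ (ht ht')
    have h2 := hf _ (mem_curveTrace (Set.Ioo_subset_Icc_self (ht ht')))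
    rw [norm_smul]
    gcongr
  -- The factor `1/(2π)` is not needed and is bounded by `1`.
  have h2 : ‖(2 * (Real.pi : ℂ) * Complex.I)⁻¹‖ ≤ 1 := by
    rw [norm_inv]
    refine inv_le_one_of_one_le₀ ?_
    simp only [norm_mul, Complex.norm_ofNat, Complex.norm_real, Complex.norm_I, mul_one,
      Real.norm_eq_abs, abs_of_pos Real.pi_pos]
    linarith [Real.pi_gt_three]
  unfold contourMean
  rw [norm_smul]
  calc _ ≤ 1 * (K * C * |(1 : ℝ) - 0|) := by gcongr
    _ = K * C := by simp

theorem exists_pos_dist_curveTrace (hθ : LipschitzOnWith K θ (Set.Icc 0 1)) {z : ℂ}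
    (hz : z ∉ curveTrace θ) : ∃ d > 0, ∀ w ∈ curveTrace θ, d ≤ ‖w - z‖ := by
  have ho : (curveTrace θ)ᶜ ∈ 𝓝 z := (isCompact_curveTrace hθ).isClosed.isOpen_compl.mem_nhds hz
  obtain ⟨d, hd, h⟩ := Metric.mem_nhds_iff.1 ho
  refine ⟨d, hd, fun w hw => ?_⟩
  by_contra! hlt
  exact h (by rwa [Metric.mem_ball, dist_eq_norm]) hw

theorem continuousOn_sub_inv {z : ℂ} (hz : z ∉ curveTrace θ) :
    ContinuousOn (fun w : ℂ => (w - z)⁻¹) (curveTrace θ) :=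
  (continuousOn_id.sub continuousOn_const).inv₀ fun w hw h =>
    hz (by have h' : w = z := sub_eq_zero.1 h; exact h' ▸ hw)

/-- Differentiation of a Cauchy-type integral. -/
theorem hasDerivAt_contourMean (hθ : LipschitzOnWith K θ (Set.Icc 0 1)) {f : ℂ → X}
    (hf : ContinuousOn f (curveTrace θ)) {z : ℂ} (hz : z ∉ curveTrace θ) :
    HasDerivAt (fun ζ => contourMean θ (fun w => (w - ζ)⁻¹ • f w))
      (contourMean θ (fun w => ((w - z) ^ 2)⁻¹ • f w)) z := by
  obtain ⟨d, hd, hdz⟩ := exists_pos_dist_curveTrace hθ hz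
  obtain ⟨C, hC⟩ := (isCompact_curveTrace hθ).exists_bound_of_continuousOn hf
  have hC0 : 0 ≤ C := (norm_nonneg _).trans
    (hC _ (mem_curveTrace (Set.left_mem_Icc.2 zero_le_one)))
  -- Halving the radius keeps the kernel uniformly bounded, which is the domination needed to
  -- differentiate under the integral.
  have hball : ∀ x ∈ Metric.ball z (d / 2), ∀ w ∈ curveTrace θ, d / 2 ≤ ‖w - x‖ := by
    intro x hx w hw
    have h1 := hdz w hw
    rw [Metric.mem_ball, dist_eq_norm] at hx
    have h2 : ‖w - z‖ ≤ ‖w - x‖ + ‖x - z‖ := by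
      simpa using norm_add_le (w - x) (x - z)
    linarith
  have hnot : ∀ x ∈ Metric.ball z (d / 2), x ∉ curveTrace θ := by
    intro x hx hxt
    have := hball x hx x hxt
    simp at this
    linarith
  have hs : Metric.ball z (d / 2) ∈ 𝓝 z := Metric.ball_mem_nhds _ (by positivity)
  have key := (intervalIntegral.hasDerivAt_integral_of_dominated_loc_of_deriv_le
    (μ := MeasureTheory.volume) (a := (0 : ℝ)) (b := 1)
    (F := fun ζ t => deriv θ t • ((θ t - ζ)⁻¹ • f (θ t)))
    (F' := fun ζ t => deriv θ t • (((θ t - ζ) ^ 2)⁻¹ • f (θ t)))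
    (bound := fun _ => K * (((d / 2) ^ 2)⁻¹ * C)) hs ?_ ?_ ?_ ?_ ?_ ?_).2
  · exact key.const_smul _
  · filter_upwards [hs] with x hx
    exact aestronglyMeasurable_contour hθ (f := fun w => (w - x)⁻¹ • f w)
      ((continuousOn_sub_inv (hnot x hx)).smul hf)
  · exact intervalIntegrable_contour hθ (f := fun w => (w - z)⁻¹ • f w)
      ((continuousOn_sub_inv hz).smul hf)
  · refine aestronglyMeasurable_contour hθ (f := fun w => ((w - z) ^ 2)⁻¹ • f w)
      (ContinuousOn.smul ?_ hf)
    exact ((continuousOn_sub_inv hz).pow 2).congr fun w _ => (inv_pow (w - z) 2).symm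
  · filter_upwards [ae_mem_Ioo_of_mem_uIoc] with t ht ht' x hx
    have h1 := norm_deriv_le_on_Ioo hθ (ht ht')
    have hm := mem_curveTrace (θ := θ) (Set.Ioo_subset_Icc_self (ht ht'))
    have h2 := hC _ hm
    have h3 := hball x hx _ hm
    rw [norm_smul, norm_smul, norm_inv, norm_pow]
    gcongr
  · exact intervalIntegrable_const
  · filter_upwards [ae_mem_Ioo_of_mem_uIoc] with t ht ht' x hx
    have hm := mem_curveTrace (θ := θ) (Set.Ioo_subset_Icc_self (ht ht'))
    have hne : θ t - x ≠ 0 := fun h => hnot x hx (by rw [sub_eq_zero] at h; exact h ▸ hm)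
    have h1 : HasDerivAt (fun x => (θ t - x)⁻¹) (((θ t - x) ^ 2)⁻¹) x := by
      have := ((hasDerivAt_id x).const_sub (θ t)).fun_inv hne
      simpa using this
    exact (h1.smul_const (f (θ t))).const_smul _

/-- The fundamental theorem of calculus for complex valued Lipschitz functions. -/
theorem integral_deriv_of_lipschitzOnWith {g : ℝ → ℂ} {L : NNReal}
    (hg : LipschitzOnWith L g (Set.Icc 0 1)) :
    ∫ t in (0 : ℝ)..1, deriv g t = g 1 - g 0 := by
  have hdiff : ∀ᵐ t : ℝ, t ∈ Set.uIoc (0 : ℝ) 1 → DifferentiableAt ℝ g t := by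
    filter_upwards [hg.ae_differentiableWithinAt_of_mem, ae_mem_Ioo_of_mem_uIoc] with t ht h1 h2
    exact (ht (Set.Ioo_subset_Icc_self (h1 h2))).differentiableAt
      (Icc_mem_nhds (h1 h2).1 (h1 h2).2)
  have hint : IntervalIntegrable (deriv g) MeasureTheory.volume 0 1 := by
    simpa using intervalIntegrable_contour hg (f := fun _ => (1 : ℂ)) continuousOn_const
  have hpart : ∀ Φ : ℂ →L[ℝ] ℝ, Φ (∫ t in (0 : ℝ)..1, deriv g t) = Φ (g 1 - g 0) := by
    intro Φ
    rw [← ContinuousLinearMap.intervalIntegral_comp_comm Φ hint, map_sub]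
    have hl : LipschitzOnWith (‖Φ‖₊ * L) (fun t => Φ (g t)) (Set.uIcc 0 1) := by
      rw [Set.uIcc_of_le zero_le_one]
      exact Φ.lipschitz.comp_lipschitzOnWith hg
    rw [← hl.absolutelyContinuousOnInterval.integral_deriv_eq_sub]
    refine intervalIntegral.integral_congr_ae ?_
    filter_upwards [hdiff] with t ht h
    exact (Φ.hasFDerivAt.comp_hasDerivAt t (ht h).hasDerivAt).deriv.symm
  exact Complex.ext (hpart Complex.reCLM) (hpart Complex.imCLM)

/-- The kernel has the single-valued primitive `-(w - z)⁻¹`, which is Lipschitz along the curve and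
takes equal values at its ends. -/
theorem contourMean_sub_sq_inv (hθ : LipschitzOnWith K θ (Set.Icc 0 1)) (hcl : θ 0 = θ 1) {z : ℂ}
    (hz : z ∉ curveTrace θ) : contourMean θ (fun w => ((w - z) ^ 2)⁻¹) = 0 := by
  obtain ⟨d, hd, hdz⟩ := exists_pos_dist_curveTrace hθ hz
  have hne : ∀ t ∈ Set.Icc (0 : ℝ) 1, θ t - z ≠ 0 := fun t ht h =>
    hz (by rw [sub_eq_zero] at h; exact h ▸ mem_curveTrace ht)
  have hl : LipschitzOnWith (K * (Real.toNNReal d * Real.toNNReal d)⁻¹)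
      (fun t => -(θ t - z)⁻¹) (Set.Icc 0 1) := by
    refine LipschitzOnWith.of_dist_le_mul fun s hs t ht => ?_
    have h1 := hθ.dist_le_mul s hs t ht
    have h2 := hdz _ (mem_curveTrace hs)
    have h3 := hdz _ (mem_curveTrace ht)
    have h4 : -(θ s - z)⁻¹ - -(θ t - z)⁻¹ = (θ s - θ t) / ((θ s - z) * (θ t - z)) := by
      field_simp [hne s hs, hne t ht]
      ring
    rw [dist_eq_norm, h4, norm_div, norm_mul, ← dist_eq_norm]
    push_cast
    rw [Real.coe_toNNReal d hd.le]
    calc _ ≤ (K * dist s t) / (d * d) := by gcongr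
      _ = _ := by rw [div_eq_mul_inv]; ring
  have h := integral_deriv_of_lipschitzOnWith hl
  have h2 : ∫ t in (0 : ℝ)..1, deriv θ t • ((θ t - z) ^ 2)⁻¹ = 0 := by
    rw [hcl, sub_self] at h
    rw [← h]
    refine intervalIntegral.integral_congr_ae ?_
    filter_upwards [hθ.ae_differentiableWithinAt_of_mem, ae_mem_Ioo_of_mem_uIoc] with t ht h1 h2
    have hd : HasDerivAt θ (deriv θ t) t := ((ht (Set.Ioo_subset_Icc_self (h1 h2))).differentiableAt
      (Icc_mem_nhds (h1 h2).1 (h1 h2).2)).hasDerivAt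
    have := ((hd.sub_const z).fun_inv (hne t (Set.Ioo_subset_Icc_self (h1 h2)))).fun_neg
    rw [this.deriv, neg_div, neg_neg, smul_eq_mul, div_eq_mul_inv]
  unfold contourMean
  rw [h2, smul_zero]

/-- The winding number integral `(2πi)⁻¹ ∮ (w - z)⁻¹ dw`. -/
def windingIntegral (θ : ℝ → ℂ) (z : ℂ) : ℂ := contourMean θ (fun w => (w - z)⁻¹)

theorem hasDerivAt_windingIntegral (hθ : LipschitzOnWith K θ (Set.Icc 0 1)) (hcl : θ 0 = θ 1)
    {z : ℂ} (hz : z ∉ curveTrace θ) : HasDerivAt (windingIntegral θ) 0 z := by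
  have h := hasDerivAt_contourMean hθ (f := fun _ => (1 : ℂ)) continuousOn_const hz
  simp only [smul_eq_mul, mul_one] at h
  rwa [contourMean_sub_sq_inv hθ hcl hz] at h

theorem eventually_windingIntegral_eq (hθ : LipschitzOnWith K θ (Set.Icc 0 1)) (hcl : θ 0 = θ 1)
    {z : ℂ} (hz : z ∉ curveTrace θ) :
    ∀ᶠ ζ in 𝓝 z, ζ ∉ curveTrace θ ∧ windingIntegral θ ζ = windingIntegral θ z := by
  obtain ⟨d, hd, h⟩ := Metric.mem_nhds_iff.1
    ((isCompact_curveTrace hθ).isClosed.isOpen_compl.mem_nhds hz)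
  filter_upwards [Metric.ball_mem_nhds z hd] with ζ hζ
  refine ⟨h hζ, ?_⟩
  refine Metric.isOpen_ball.is_const_of_deriv_eq_zero (convex_ball z d).isPreconnected
    (fun x hx => ?_) (fun x hx => ?_) hζ (Metric.mem_ball_self hd)
  · exact (hasDerivAt_windingIntegral hθ hcl (h hx)).differentiableAt.differentiableWithinAt
  · exact (hasDerivAt_windingIntegral hθ hcl (h hx)).deriv

/-- Points far away are not enclosed. -/
theorem exists_windingIntegral_eq_zero (hθ : LipschitzOnWith K θ (Set.Icc 0 1))
    (hcl : θ 0 = θ 1) : ∃ s, s ∉ curveTrace θ ∧ windingIntegral θ s = 0 := by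
  obtain ⟨r, hr⟩ := (isCompact_curveTrace hθ).isBounded.exists_norm_le
  have hre : ∀ w ∈ curveTrace θ, w.re ≤ r := fun w hw => (Complex.re_le_norm w).trans (hr w hw)
  have hout : ∀ z : ℂ, r < z.re → z ∉ curveTrace θ := fun z hz hzt => (hre z hzt).not_gt hz
  -- A half-plane missing the curve is connected, so the winding integral is constant there; the
  -- length bound sends it to zero far to the right.
  have hconst : ∀ z : ℂ, r < z.re → windingIntegral θ z = windingIntegral θ ((r + 1 : ℝ) : ℂ) := by
    intro z hz
    have ho : IsOpen {z : ℂ | r < z.re} := isOpen_lt continuous_const Complex.continuous_re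
    refine ho.is_const_of_deriv_eq_zero (convex_halfSpace_re_gt r).isPreconnected
      (fun x hx => ?_) (fun x hx => ?_) hz (by simp)
    · exact (hasDerivAt_windingIntegral hθ hcl (hout x hx)).differentiableAt.differentiableWithinAt
    · exact (hasDerivAt_windingIntegral hθ hcl (hout x hx)).deriv
  refine ⟨((r + 1 : ℝ) : ℂ), hout _ (by simp), ?_⟩
  have hb : ∀ x : ℝ, r < x → ‖windingIntegral θ ((r + 1 : ℝ) : ℂ)‖ ≤ K * (x - r)⁻¹ := by
    intro x hx
    rw [← hconst x (by simpa using hx)]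
    refine norm_contourMean_le hθ fun w hw => ?_
    rw [norm_inv]
    have h1 := Complex.abs_re_le_norm (w - x)
    have h2 := neg_abs_le (w - x).re
    have h3 := hre w hw
    simp only [Complex.sub_re, Complex.ofReal_re] at h1 h2
    exact inv_anti₀ (by linarith) (by linarith)
  have hlim : Tendsto (fun x : ℝ => (K : ℝ) * (x - r)⁻¹) atTop (𝓝 ((K : ℝ) * 0)) :=
    (tendsto_inv_atTop_zero.comp (tendsto_atTop_add_const_right _ (-r) tendsto_id)).const_mul _
  rw [mul_zero] at hlim
  exact norm_le_zero_iff.1 (ge_of_tendsto hlim ((eventually_gt_atTop r).mono hb))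

end Contour

/-! ### Riesz projectors in a Banach algebra -/

section Riesz

variable {𝔸 : Type*} [NormedRing 𝔸] [NormedAlgebra ℂ 𝔸] [CompleteSpace 𝔸]
  {θ : ℝ → ℂ} {K : NNReal} {a : 𝔸}

/-- The Riesz integral `(2πi)⁻¹ ∮ (w - a)⁻¹ dw`. -/
def rieszIntegral (θ : ℝ → ℂ) (a : 𝔸) : 𝔸 := contourMean θ (fun w => resolvent a w)

theorem continuousOn_resolvent {s : Set ℂ} (hs : Disjoint s (spectrum ℂ a)) :
    ContinuousOn (fun w : ℂ => resolvent a w) s := fun w hw =>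
  (spectrum.hasDerivAt_resolvent_const_left (a := a) (k := w)
    (by simpa [spectrum] using Set.disjoint_left.1 hs hw)).continuousAt.continuousWithinAt

theorem resolvent_sub_resolvent {𝔸 : Type*} [NormedRing 𝔸] [NormedAlgebra ℂ 𝔸] {a : 𝔸}
    {w z : ℂ} (hw : w ∉ spectrum ℂ a) (hz : z ∉ spectrum ℂ a) :
    resolvent a w = resolvent a z - (w - z) • (resolvent a w * resolvent a z) := by
  rw [spectrum.notMem_iff] at hw hz
  have h1 : resolvent a w * (algebraMap ℂ 𝔸 w - a) = 1 := Ring.inverse_mul_cancel _ hw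
  have h2 : (algebraMap ℂ 𝔸 z - a) * resolvent a z = 1 := Ring.mul_inverse_cancel _ hz
  have h3 : (w - z) • (resolvent a w * resolvent a z) =
      resolvent a w * ((algebraMap ℂ 𝔸 w - a) - (algebraMap ℂ 𝔸 z - a)) * resolvent a z := by
    rw [sub_sub_sub_cancel_right, ← map_sub, mul_assoc, ← Algebra.smul_def, mul_smul_comm]
  rw [h3, mul_sub, h1, sub_mul, one_mul, mul_assoc, h2, mul_one, sub_sub_cancel]

theorem contourMean_mul_right (hθ : LipschitzOnWith K θ (Set.Icc 0 1)) (b : 𝔸) {f : ℂ → 𝔸}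
    (hf : ContinuousOn f (curveTrace θ)) :
    contourMean θ (fun z => f z * b) = contourMean θ f * b :=
  contourMean_clm hθ ((ContinuousLinearMap.mul ℂ 𝔸).flip b) hf

theorem contourMean_mul_left (hθ : LipschitzOnWith K θ (Set.Icc 0 1)) (b : 𝔸) {f : ℂ → 𝔸}
    (hf : ContinuousOn f (curveTrace θ)) :
    contourMean θ (fun z => b * f z) = b * contourMean θ f :=
  contourMean_clm hθ (ContinuousLinearMap.mul ℂ 𝔸 b) hf

theorem contourMean_sub_inv_smul_const {X : Type*} [NormedAddCommGroup X] [NormedSpace ℂ X]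
    [CompleteSpace X] (hθ : LipschitzOnWith K θ (Set.Icc 0 1)) {z : ℂ} (hz : z ∉ curveTrace θ)
    (x : X) : contourMean θ (fun w => (w - z)⁻¹ • x) = windingIntegral θ z • x :=
  contourMean_clm hθ ((ContinuousLinearMap.id ℂ ℂ).smulRight x) (continuousOn_sub_inv hz)

/-- Divide the resolvent identity by `w - z` and integrate. The left side is holomorphic at every
point off the curve, so it continues the right side across the spectrum. -/
theorem contourMean_sub_inv_smul_resolvent (hθ : LipschitzOnWith K θ (Set.Icc 0 1))
    (ha : Disjoint (curveTrace θ) (spectrum ℂ a)) {z : ℂ} (hz : z ∉ curveTrace θ)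
    (hza : z ∉ spectrum ℂ a) :
    contourMean θ (fun w => (w - z)⁻¹ • resolvent a w) =
      (windingIntegral θ z • (1 : 𝔸) - rieszIntegral θ a) * resolvent a z := by
  have hR := continuousOn_resolvent ha
  have h1 : Set.EqOn (fun w => (w - z)⁻¹ • resolvent a w)
      (fun w => (w - z)⁻¹ • resolvent a z - resolvent a w * resolvent a z) (curveTrace θ) := by
    intro w hw
    have hne : w - z ≠ 0 := fun h => hz (by rw [sub_eq_zero] at h; exact h ▸ hw)
    have h := resolvent_sub_resolvent (Set.disjoint_left.1 ha hw) hza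
    simp only
    conv_lhs => rw [h]
    rw [smul_sub, smul_smul, inv_mul_cancel₀ hne, one_smul]
  rw [contourMean_congr h1, contourMean_sub hθ
    (f := fun w => (w - z)⁻¹ • resolvent a z) (g := fun w => resolvent a w * resolvent a z)
    ((continuousOn_sub_inv hz).smul continuousOn_const) (hR.mul continuousOn_const),
    contourMean_sub_inv_smul_const hθ hz, contourMean_mul_right hθ _ hR, sub_mul, smul_mul_assoc,
    one_mul, rieszIntegral]

/-- If `z ↦ C (z - a)⁻¹` extends to an entire function, then `C = 0`. -/
theorem eq_zero_of_entire_mul_resolvent {C : 𝔸} {F : ℂ → 𝔸} (hF : Differentiable ℂ F)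
    (h : ∀ z ∉ spectrum ℂ a, F z = C * resolvent a z) : C = 0 := by
  have hb : Bornology.IsBounded (spectrum ℂ a) := spectrum.isBounded a
  have hev : ∀ᶠ z in cocompact ℂ, z ∉ spectrum ℂ a := by
    rw [← Metric.cobounded_eq_cocompact]
    exact Bornology.isBounded_def.1 hb
  -- The resolvent vanishes at infinity, so Liouville's theorem forces `F = 0`; an invertible value
  -- of the resolvent then cancels.
  have hlim : Tendsto F (cocompact ℂ) (𝓝 0) := by
    have h1 : Tendsto (fun z => C * resolvent a z) (cocompact ℂ) (𝓝 (C * 0)) := by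
      rw [← Metric.cobounded_eq_cocompact]
      exact (spectrum.resolvent_tendsto_cobounded a (𝕜 := ℂ)).const_mul C
    rw [mul_zero] at h1
    exact h1.congr' (hev.mono fun z hz => (h z hz).symm)
  obtain ⟨z, hz⟩ := hev.exists
  have h0 : C * resolvent a z = 0 := by
    rw [← h z hz]
    exact hF.apply_eq_of_tendsto_cocompact z hlim
  have hu : resolvent a z * (algebraMap ℂ 𝔸 z - a) = 1 :=
    Ring.inverse_mul_cancel _ (spectrum.notMem_iff.1 hz)
  rw [← mul_one C, ← hu, ← mul_assoc, h0, zero_mul]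

/-- A version of Dixon's argument: `C` vanishes if, at each point `z` of the spectrum, it is a left
multiple of `n(z) - P` that depends on the winding number `n(z)` only. -/
theorem eq_zero_of_winding (hθ : LipschitzOnWith K θ (Set.Icc 0 1)) (hcl : θ 0 = θ 1)
    (ha : Disjoint (curveTrace θ) (spectrum ℂ a)) {C : 𝔸} (D : ℂ → 𝔸)
    (h : ∀ z ∈ spectrum ℂ a, D (windingIntegral θ z) *
      (windingIntegral θ z • (1 : 𝔸) - rieszIntegral θ a) = C) : C = 0 := by
  classical
  have hR := continuousOn_resolvent ha
  set G : ℂ → 𝔸 := fun z => contourMean θ (fun w => (w - z)⁻¹ • resolvent a w) with hG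
  -- Near a spectral point the winding number is constant, and off the spectrum `G = (n - P) R`. The
  -- two branches therefore agree there with the single holomorphic function `D n * G`.
  let F : ℂ → 𝔸 := fun z =>
    if z ∈ spectrum ℂ a then D (windingIntegral θ z) * G z else C * resolvent a z
  refine eq_zero_of_entire_mul_resolvent (a := a) (F := F) (fun z => ?_)
    fun z hz => if_neg hz
  by_cases hz : z ∈ spectrum ℂ a
  · have hzt : z ∉ curveTrace θ := Set.disjoint_right.1 ha hz
    have hd : DifferentiableAt ℂ (fun ζ => D (windingIntegral θ z) * G ζ) z :=
      (hasDerivAt_contourMean hθ hR hzt).differentiableAt.const_mul _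
    refine hd.congr_of_eventuallyEq ?_
    filter_upwards [eventually_windingIntegral_eq hθ hcl hzt] with ζ hζ
    by_cases hζs : ζ ∈ spectrum ℂ a
    · simp only [F, if_pos hζs, hζ.2]
    · simp only [F, if_neg hζs]
      rw [hG]
      simp only
      rw [contourMean_sub_inv_smul_resolvent hθ ha hζ.1 hζs, hζ.2, ← mul_assoc, h z hz]
  · have hd : DifferentiableAt ℂ (fun ζ => C * resolvent a ζ) z :=
      (spectrum.hasDerivAt_resolvent_const_left (a := a) (k := z)
        (by simpa [spectrum] using hz)).differentiableAt.const_mul _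
    refine hd.congr_of_eventuallyEq ?_
    filter_upwards [(spectrum.isClosed a).isOpen_compl.mem_nhds hz] with ζ hζ
    exact if_neg hζ

/-- With winding number `0` the factor `n - P` is `-P`, so the constant multiplier `-1` produces `P`
itself. -/
theorem rieszIntegral_eq_zero (hθ : LipschitzOnWith K θ (Set.Icc 0 1)) (hcl : θ 0 = θ 1)
    (h : ∀ z ∈ spectrum ℂ a, z ∉ curveTrace θ ∧ windingIntegral θ z = 0) :
    rieszIntegral θ a = 0 := by
  have ha : Disjoint (curveTrace θ) (spectrum ℂ a) := Set.disjoint_right.2 fun z hz => (h z hz).1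
  refine eq_zero_of_winding hθ hcl ha (fun _ => -1) fun z hz => ?_
  rw [(h z hz).2]
  simp

theorem isIdempotentElem_rieszIntegral (hθ : LipschitzOnWith K θ (Set.Icc 0 1)) (hcl : θ 0 = θ 1)
    (h : ∀ z ∈ spectrum ℂ a, z ∉ curveTrace θ ∧
      (windingIntegral θ z = 0 ∨ windingIntegral θ z = 1)) :
    IsIdempotentElem (rieszIntegral θ a) := by
  have ha : Disjoint (curveTrace θ) (spectrum ℂ a) := Set.disjoint_right.2 fun z hz => (h z hz).1
  -- `P(1 - P)` is a left multiple of both `0 - P` and `1 - P`, with multipliers `-(1 - P)` and `P`.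
  have key := eq_zero_of_winding (C := rieszIntegral θ a * (1 - rieszIntegral θ a)) hθ hcl ha
    (fun n => if n = 0 then -(1 - rieszIntegral θ a) else rieszIntegral θ a) fun z hz => by
      rcases (h z hz).2 with h0 | h0 <;> rw [h0]
      · simp [mul_sub, sub_mul]
      · simp
  rw [mul_sub, mul_one, sub_eq_zero] at key
  exact key.symm

/-- If `p` is an idempotent commuting with `a` and `z - a` is invertible on the complement of `p`
for all `z` with non-zero winding number, then the Riesz integral vanishes on this complement. -/
theorem rieszIntegral_mul_compl_eq_zero (hθ : LipschitzOnWith K θ (Set.Icc 0 1)) (hcl : θ 0 = θ 1)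
    (ha : Disjoint (curveTrace θ) (spectrum ℂ a)) {p : 𝔸} (hp : IsIdempotentElem p)
    (hpa : Commute p a)
    (h : ∀ z : ℂ, (z ∉ curveTrace θ ∧ windingIntegral θ z = 0) ∨
      ∃ x : 𝔸, p * x = 0 ∧ x * p = 0 ∧ x * (algebraMap ℂ 𝔸 z - a) = 1 - p ∧
        (algebraMap ℂ 𝔸 z - a) * x = 1 - p) :
    rieszIntegral θ a * (1 - p) = 0 := by
  obtain ⟨s, hs, hs0⟩ := exists_windingIntegral_eq_zero hθ hcl
  have hpp : p * p = p := hp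
  have hpa' : p * a = a * p := hpa
  -- `b` agrees with `a` on the complement of `p`, while on `p` it is the scalar `s`, which is not
  -- enclosed. No spectral point of `b` is enclosed, so its Riesz integral vanishes.
  set b : 𝔸 := a * (1 - p) + s • p with hb
  have hbq : ∀ z : ℂ, (algebraMap ℂ 𝔸 z - b) * (1 - p) = (algebraMap ℂ 𝔸 z - a) * (1 - p) := by
    intro z
    have h1 : (1 - p) * (1 - p) = 1 - p := hp.one_sub
    have h2 : p * (1 - p) = 0 := by rw [mul_sub, mul_one, hpp, sub_self]
    rw [hb, sub_mul, add_mul, mul_assoc a, h1, smul_mul_assoc, h2, smul_zero, add_zero, sub_mul]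
  have hb0 : ∀ z ∈ spectrum ℂ b, z ∉ curveTrace θ ∧ windingIntegral θ z = 0 := by
    intro z hz
    by_cases hzs : z = s
    · subst hzs
      exact ⟨hs, hs0⟩
    rcases h z with h | ⟨x, h1, h2, h3, h4⟩
    · exact h
    refine absurd hz (spectrum.notMem_iff.2 ?_)
    have hzs' : z - s ≠ 0 := sub_ne_zero.2 hzs
    have hbz : algebraMap ℂ 𝔸 z - b = (algebraMap ℂ 𝔸 z - a) * (1 - p) + (z - s) • p := by
      rw [hb, Algebra.algebraMap_eq_smul_one]
      simp only [mul_sub, sub_mul, mul_one, one_mul, smul_mul_assoc, sub_smul]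
      abel
    have hcomm : (1 - p) * (algebraMap ℂ 𝔸 z - a) = (algebraMap ℂ 𝔸 z - a) * (1 - p) := by
      have := Algebra.commutes z p
      simp only [sub_mul, mul_sub, one_mul, mul_one, hpa', this]
      abel
    have hpq : (1 - p) * p = 0 := by rw [sub_mul, one_mul, hpp, sub_self]
    have hqp : p * (1 - p) = 0 := by rw [mul_sub, mul_one, hpp, sub_self]
    have hxq : (1 - p) * x = x := by rw [sub_mul, one_mul, h1, sub_zero]
    refine isUnit_iff_exists.2 ⟨x + (z - s)⁻¹ • p, ?_, ?_⟩
    · rw [hbz, add_mul, mul_add, mul_add, mul_assoc, hxq, h4, mul_smul_comm, mul_assoc, hpq,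
        mul_zero, smul_zero, add_zero, smul_mul_assoc, h1, smul_zero, zero_add, smul_mul_smul_comm,
        hpp, mul_inv_cancel₀ hzs', one_smul, sub_add_cancel]
    · rw [hbz, add_mul, mul_add, mul_add, ← mul_assoc, h3, hp.one_sub, mul_smul_comm, h2,
        smul_zero, add_zero, smul_mul_assoc, ← hcomm, ← mul_assoc, hqp, zero_mul, smul_zero,
        zero_add, smul_mul_smul_comm, hpp, inv_mul_cancel₀ hzs', one_smul, sub_add_cancel]
  have hbd : Disjoint (curveTrace θ) (spectrum ℂ b) :=
    Set.disjoint_right.2 fun z hz => (hb0 z hz).1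
  rw [rieszIntegral, ← contourMean_mul_right hθ _ (continuousOn_resolvent ha)]
  have heq : Set.EqOn (fun z => resolvent a z * (1 - p)) (fun z => resolvent b z * (1 - p))
      (curveTrace θ) := by
    intro z hz
    have h1 : resolvent a z * (algebraMap ℂ 𝔸 z - a) = 1 :=
      Ring.inverse_mul_cancel _ (spectrum.notMem_iff.1 (Set.disjoint_left.1 ha hz))
    have h2 : resolvent b z * (algebraMap ℂ 𝔸 z - b) = 1 :=
      Ring.inverse_mul_cancel _ (spectrum.notMem_iff.1 (Set.disjoint_left.1 hbd hz))
    have h1' : (algebraMap ℂ 𝔸 z - a) * resolvent a z = 1 :=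
      Ring.mul_inverse_cancel _ (spectrum.notMem_iff.1 (Set.disjoint_left.1 ha hz))
    have hcomm : (algebraMap ℂ 𝔸 z - a) * (1 - p) = (1 - p) * (algebraMap ℂ 𝔸 z - a) := by
      have := Algebra.commutes z p
      simp only [sub_mul, mul_sub, one_mul, mul_one, hpa', this]
      abel
    have h3 : (1 - p) * resolvent a z = resolvent a z * (1 - p) := by
      calc (1 - p) * resolvent a z
          = resolvent a z * ((algebraMap ℂ 𝔸 z - a) * (1 - p)) * resolvent a z := by
            rw [← mul_assoc, h1, one_mul]
        _ = resolvent a z * (1 - p) := by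
            rw [hcomm, mul_assoc, mul_assoc, h1', mul_one]
    simp only
    calc resolvent a z * (1 - p)
        = resolvent b z * ((algebraMap ℂ 𝔸 z - b) * (1 - p)) * resolvent a z := by
          rw [← mul_assoc, h2, one_mul, h3]
      _ = resolvent b z * (1 - p) := by
          rw [hbq, hcomm, mul_assoc, mul_assoc, h1', mul_one]
  rw [contourMean_congr heq, contourMean_mul_right hθ _ (continuousOn_resolvent hbd),
    ← rieszIntegral, rieszIntegral_eq_zero hθ hcl hb0, zero_mul]

/-- If `c` is a point off the curve with winding number `0`, or not in the spectrum, then the Riesz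
integral is a left multiple of `a - c`. -/
theorem exists_rieszIntegral_eq_mul (hθ : LipschitzOnWith K θ (Set.Icc 0 1))
    (ha : Disjoint (curveTrace θ) (spectrum ℂ a)) {c : ℂ}
    (hc : (c ∉ curveTrace θ ∧ windingIntegral θ c = 0) ∨ c ∉ spectrum ℂ a) :
    ∃ G : 𝔸, rieszIntegral θ a = (a - algebraMap ℂ 𝔸 c) * G := by
  rcases hc with ⟨hc, hc0⟩ | hc
  · have hR := continuousOn_resolvent ha
    have hcR : ContinuousOn (fun w => (w - c)⁻¹ • resolvent a w) (curveTrace θ) :=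
      (continuousOn_sub_inv hc).smul hR
    refine ⟨contourMean θ (fun w => (w - c)⁻¹ • resolvent a w), ?_⟩
    rw [← contourMean_mul_left hθ _ hcR]
    -- Split `w - c = (w - a) + (a - c)`; the scalar term integrates to the winding number of `c`,
    -- which is zero.
    have heq : Set.EqOn (fun w => resolvent a w) (fun w => (w - c)⁻¹ • (1 : 𝔸) +
        (a - algebraMap ℂ 𝔸 c) * ((w - c)⁻¹ • resolvent a w)) (curveTrace θ) := by
      intro w hw
      have hne : w - c ≠ 0 := fun h => hc (by rw [sub_eq_zero] at h; exact h ▸ hw)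
      have h1 : (algebraMap ℂ 𝔸 w - a) * resolvent a w = 1 :=
        Ring.mul_inverse_cancel _ (spectrum.notMem_iff.1 (Set.disjoint_left.1 ha hw))
      have h2 : (a - algebraMap ℂ 𝔸 c) = algebraMap ℂ 𝔸 (w - c) - (algebraMap ℂ 𝔸 w - a) := by
        rw [map_sub]; abel
      simp only
      rw [mul_smul_comm, h2, sub_mul, h1, ← Algebra.smul_def, smul_sub, smul_smul,
        inv_mul_cancel₀ hne, one_smul, add_sub_cancel]
    rw [rieszIntegral, contourMean_congr heq, contourMean_add hθ
      (f := fun w => (w - c)⁻¹ • (1 : 𝔸))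
      (g := fun w => (a - algebraMap ℂ 𝔸 c) * ((w - c)⁻¹ • resolvent a w))
      ((continuousOn_sub_inv hc).smul continuousOn_const) (continuousOn_const.mul hcR),
      contourMean_sub_inv_smul_const hθ hc, hc0, zero_smul, zero_add]
  · have h1 : (algebraMap ℂ 𝔸 c - a) * resolvent a c = 1 :=
      Ring.mul_inverse_cancel _ (spectrum.notMem_iff.1 hc)
    refine ⟨-(resolvent a c * rieszIntegral θ a), ?_⟩
    rw [mul_neg, ← mul_assoc, ← neg_mul, ← neg_mul, neg_sub, h1, one_mul]

/-- The Riesz integral depends continuously on the algebra element. -/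
theorem tendsto_rieszIntegral (hθ : LipschitzOnWith K θ (Set.Icc 0 1))
    (ha : Disjoint (curveTrace θ) (spectrum ℂ a)) :
    Tendsto (fun b : 𝔸 => rieszIntegral θ b) (𝓝 a) (𝓝 (rieszIntegral θ a)) := by
  rw [Metric.tendsto_nhds]
  intro ε hε
  -- `K + 1` because the Lipschitz constant may be zero.
  have hη : 0 < ε / (K + 1) := by positivity
  have hcont : ∀ z ∈ curveTrace θ, ContinuousAt (fun q : 𝔸 × ℂ => resolvent q.1 q.2) (a, z) := by
    intro z hz
    have hu := spectrum.notMem_iff.1 (Set.disjoint_left.1 ha hz)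
    have h1 : ContinuousAt (Ring.inverse : 𝔸 → 𝔸) (algebraMap ℂ 𝔸 z - a) :=
      hu.unit_spec ▸ NormedRing.inverse_continuousAt hu.unit
    have h2 : Continuous (fun q : 𝔸 × ℂ => algebraMap ℂ 𝔸 q.2 - q.1) :=
      ((continuous_algebraMap ℂ 𝔸).comp continuous_snd).sub continuous_fst
    exact ContinuousAt.comp (f := fun q : 𝔸 × ℂ => algebraMap ℂ 𝔸 q.2 - q.1) (x := (a, z)) h1
      h2.continuousAt
  -- Joint continuity in the element and the point becomes uniform along the curve by compactness.
  have hunif : ∀ᶠ b in 𝓝 a, ∀ z ∈ curveTrace θ,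
      ‖resolvent b z - resolvent a z‖ < ε / (K + 1) := by
    refine (isCompact_curveTrace hθ).eventually_forall_of_forall_eventually fun z hz => ?_
    have h1 := hcont z hz
    have h2 : ContinuousAt (fun q : 𝔸 × ℂ => resolvent a q.2) (a, z) :=
      ContinuousAt.comp (f := fun q : 𝔸 × ℂ => (a, q.2)) (x := (a, z)) h1
        (continuous_const.prodMk continuous_snd).continuousAt
    have h3 := (h1.sub h2).norm
    refine h3.eventually_lt continuousAt_const ?_
    simpa using hη
  have hspec : ∀ᶠ b in 𝓝 a, Disjoint (curveTrace θ) (spectrum ℂ b) := by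
    have h := (upperHemicontinuous_spectrum ℂ 𝔸).upperHemicontinuousAt a (curveTrace θ)ᶜ
      ((isCompact_curveTrace hθ).isClosed.isOpen_compl.mem_nhdsSet.2
        (Set.disjoint_right.1 ha))
    filter_upwards [h] with b hb
    exact Set.disjoint_right.2 fun z hz => subset_of_mem_nhdsSet hb hz
  filter_upwards [hunif, hspec] with b hb hbs
  rw [dist_eq_norm, rieszIntegral, rieszIntegral,
    ← contourMean_sub hθ (continuousOn_resolvent hbs) (continuousOn_resolvent ha)]
  refine (norm_contourMean_le hθ fun z hz => (hb z hz).le).trans_lt ?_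
  rw [mul_div_assoc', div_lt_iff₀ (by positivity)]
  nlinarith

end Riesz

/-- Two idempotent operators at distance less than one have ranges of the same dimension. -/
theorem finrank_range_le_of_norm_sub_lt_one {V : Type*} [NormedAddCommGroup V] [NormedSpace ℂ V]
    {p q : V →L[ℂ] V} (hq : IsIdempotentElem q) (hpq : ‖p - q‖ < 1)
    [FiniteDimensional ℂ (LinearMap.range (p : V →ₗ[ℂ] V))] :
    FiniteDimensional ℂ (LinearMap.range (q : V →ₗ[ℂ] V)) ∧
      Module.finrank ℂ (LinearMap.range (q : V →ₗ[ℂ] V)) ≤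
        Module.finrank ℂ (LinearMap.range (p : V →ₗ[ℂ] V)) := by
  let f : LinearMap.range (q : V →ₗ[ℂ] V) →ₗ[ℂ] LinearMap.range (p : V →ₗ[ℂ] V) :=
    (p : V →ₗ[ℂ] V).rangeRestrict.comp (LinearMap.range (q : V →ₗ[ℂ] V)).subtype
  have hf : Function.Injective f := by
    rw [← LinearMap.ker_eq_bot, LinearMap.ker_eq_bot']
    rintro ⟨x, y, rfl⟩ h
    have h1 : p (q y) = 0 := congrArg Subtype.val h
    have h2 : q (q y) = q y := congrArg (fun T : V →L[ℂ] V => T y) hq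
    have h3 : ‖q y‖ ≤ ‖p - q‖ * ‖q y‖ := by
      have := (p - q).le_opNorm (q y)
      rwa [sub_apply, h1, h2, zero_sub, norm_neg] at this
    have h4 : ‖q y‖ = 0 := by nlinarith [norm_nonneg (q y)]
    exact Subtype.ext (norm_eq_zero.1 h4)
  exact ⟨Module.Finite.of_injective f hf, LinearMap.finrank_le_finrank_of_injective hf⟩

/-! ### Pseudo-resolvents reduced by an idempotent -/

section PseudoResolvent

variable {𝔸 : Type*} [NormedRing 𝔸] [NormedAlgebra ℂ 𝔸]

/-- A family satisfying the resolvent identity on the set `ρ`, together with an idempotent `p`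
that commutes with it. -/
structure IsReducedPseudoResolvent (ρ : Set ℂ) (R : ℂ → 𝔸) (p : 𝔸) : Prop where
  identity : ∀ ζ ∈ ρ, ∀ ξ ∈ ρ, R ζ - R ξ = (ξ - ζ) • (R ζ * R ξ)
  idempotent : p * p = p
  commute : ∀ ζ ∈ ρ, p * R ζ = R ζ * p

variable {ρ : Set ℂ} {R : ℂ → 𝔸} {p : 𝔸}

theorem IsReducedPseudoResolvent.mul_comm (h : IsReducedPseudoResolvent ρ R p) {ζ ξ : ℂ}
    (hζ : ζ ∈ ρ) (hξ : ξ ∈ ρ) : R ζ * R ξ = R ξ * R ζ := by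
  by_cases hne : ξ = ζ
  · rw [hne]
  have h1 := h.identity ζ hζ ξ hξ
  have h2 := h.identity ξ hξ ζ hζ
  rw [← neg_sub (R ζ), h1, ← neg_sub ξ ζ, neg_smul, neg_inj] at h2
  exact smul_right_injective 𝔸 (sub_ne_zero.2 hne) h2

/-- With `d = ζ - ξ` the inverse is `d + d² R(ξ)(1 - p)`, by the resolvent identity. Only algebra
enters, so the statement serves operators on `H` and on `V` alike. -/
theorem IsReducedPseudoResolvent.isUnit (h : IsReducedPseudoResolvent ρ R p) {ζ ξ : ℂ}
    (hζ : ζ ∈ ρ) (hξ : ξ ∈ ρ) (hne : ξ ≠ ζ) :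
    IsUnit (algebraMap ℂ 𝔸 (ζ - ξ)⁻¹ - R ζ * (1 - p)) := by
  have hd : ζ - ξ ≠ 0 := sub_ne_zero.2 hne.symm
  set d := ζ - ξ with hdd
  have h1 : R ξ = R ζ + d • (R ζ * R ξ) := by
    rw [← sub_eq_iff_eq_add', ← neg_sub, h.identity ζ hζ ξ hξ, ← neg_smul, neg_sub]
  have hq : (1 - p) * (1 - p) = 1 - p := IsIdempotentElem.one_sub h.idempotent
  have hcζ : (1 - p) * R ζ = R ζ * (1 - p) := by
    rw [sub_mul, mul_sub, one_mul, mul_one, h.commute ζ hζ]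
  have hcξ : (1 - p) * R ξ = R ξ * (1 - p) := by
    rw [sub_mul, mul_sub, one_mul, mul_one, h.commute ξ hξ]
  set x := R ζ * (1 - p) with hx
  set y := R ξ * (1 - p) with hy
  have e1 : x * y = R ζ * R ξ * (1 - p) := by
    rw [hx, hy, mul_assoc, ← mul_assoc (1 - p), hcξ, mul_assoc, hq, mul_assoc]
  have e2 : y * x = x * y := by
    rw [e1, hx, hy, mul_assoc, ← mul_assoc (1 - p), hcζ, mul_assoc, hq, ← mul_assoc,
      h.mul_comm hξ hζ]
  have e3 : y = x + d • (x * y) := by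
    rw [e1, hy, hx, ← smul_mul_assoc, ← add_mul, ← h1]
  have hd2 : d⁻¹ * d ^ 2 = d := by field_simp
  have e4 : d • y = d • x + d ^ 2 • (x * y) := by
    rw [pow_two, mul_smul, ← smul_add, ← e3]
  rw [Algebra.algebraMap_eq_smul_one]
  refine isUnit_iff_exists.2 ⟨d • 1 + d ^ 2 • y, ?_, ?_⟩
  · rw [sub_mul, mul_add, mul_add, smul_mul_smul_comm, inv_mul_cancel₀ hd, smul_mul_smul_comm,
      one_mul, one_mul, mul_smul_comm, mul_one, mul_smul_comm, one_smul, hd2, e4]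
    abel
  · rw [mul_sub, add_mul, add_mul, smul_mul_smul_comm, mul_inv_cancel₀ hd, smul_mul_smul_comm,
      mul_one, mul_one, smul_mul_assoc, one_mul, smul_mul_assoc, e2, one_smul,
      _root_.mul_comm (d ^ 2), hd2, e4]
    abel

/-- The map `t ↦ ζ - t⁻¹` carries punctured neighbourhoods of `(ζ - l)⁻¹` to punctured
neighbourhoods of `l`. -/
theorem IsReducedPseudoResolvent.eventually_notMem_spectrum (h : IsReducedPseudoResolvent ρ R p)
    {ζ l : ℂ} (hζ : ζ ∈ ρ) (hne : l ≠ ζ) (hl : ∀ᶠ ξ in 𝓝[≠] l, ξ ∈ ρ) :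
    ∀ᶠ t in 𝓝[≠] (ζ - l)⁻¹, t ∉ spectrum ℂ (R ζ * (1 - p)) := by
  have hd : ζ - l ≠ 0 := sub_ne_zero.2 hne.symm
  have ht : Tendsto (fun t : ℂ => ζ - t⁻¹) (𝓝[≠] (ζ - l)⁻¹) (𝓝[≠] l) := by
    refine tendsto_nhdsWithin_iff.2 ⟨?_, ?_⟩
    · have h1 : ContinuousAt (fun t : ℂ => ζ - t⁻¹) (ζ - l)⁻¹ :=
        continuousAt_const.sub (continuousAt_inv₀ (inv_ne_zero hd))
      have h2 := h1.tendsto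
      rw [inv_inv, sub_sub_cancel] at h2
      exact h2.mono_left nhdsWithin_le_nhds
    · filter_upwards [self_mem_nhdsWithin] with t ht h'
      have h'' : ζ - t⁻¹ = l := h'
      exact ht (by rw [← h'', sub_sub_cancel, inv_inv]; rfl)
  have h0 : ∀ᶠ t : ℂ in 𝓝[≠] (ζ - l)⁻¹, t ≠ 0 :=
    (eventually_ne_nhds (inv_ne_zero hd)).filter_mono nhdsWithin_le_nhds
  filter_upwards [ht.eventually hl, h0] with t ht ht0
  have := h.isUnit hζ ht (fun h' => ht0 (by simpa using h'))
  rw [sub_sub_cancel, inv_inv] at this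
  exact spectrum.notMem_iff.2 this

end PseudoResolvent

/-! ### Rational functions of a pseudo-resolvent -/

theorem commute_aeval {𝔸 : Type*} [Ring 𝔸] [Algebra ℂ 𝔸] {a b : 𝔸} (h : Commute b a)
    (f : Polynomial ℂ) : Commute b (Polynomial.aeval a f) := by
  induction f using Polynomial.induction_on' with
  | add f g hf hg => rw [map_add]; exact hf.add_right hg
  | monomial n x =>
    rw [Polynomial.aeval_monomial]
    exact (Algebra.commute_algebraMap_right x b).mul_right (h.pow_right n)

section RationalFilter

variable {𝔸 : Type*} [NormedRing 𝔸] [NormedAlgebra ℂ 𝔸] [CompleteSpace 𝔸] [Nontrivial 𝔸]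
  {ρ : Set ℂ} {R : ℂ → 𝔸} {p : 𝔸}

open Polynomial in
/-- Spectral mapping for a rational function of a pseudo-resolvent: `μ - r` is invertible on the
complement of `p` if `r ≠ μ` on the spectrum of the reduced pseudo-resolvent. -/
theorem IsReducedPseudoResolvent.exists_inverse (h : IsReducedPseudoResolvent ρ R p) {ζ : ℂ}
    (hζ : ζ ∈ ρ) {N : ℕ} {c : ℂ} {w z : Fin N → ℂ} (hz : ∀ k, z k ∈ ρ) {μ : ℂ} (hμc : μ ≠ c)
    (hμ : ∀ t ∈ spectrum ℂ (R ζ * (1 - p)), t ≠ 0 →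
      (∀ k, z k ≠ ζ - t⁻¹) ∧ ratFilter c w z (ζ - t⁻¹) ≠ μ) :
    ∃ x : 𝔸, p * x = 0 ∧ x * p = 0 ∧
      x * (algebraMap ℂ 𝔸 μ - (c • 1 + ∑ k, w k • R (z k))) = 1 - p ∧
      (algebraMap ℂ 𝔸 μ - (c • 1 + ∑ k, w k • R (z k))) * x = 1 - p := by
  classical
  set a : 𝔸 := R ζ * (1 - p) with ha
  set T : 𝔸 := c • 1 + ∑ k, w k • R (z k) with hT
  -- On the complement of `p`, `R (z k)` is `a` divided by `ℓ k` at `a`. Thus `Q` is the common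
  -- denominator and `f` the numerator of `μ - r` in the variable `t = (ζ - ξ)⁻¹`.
  let ℓ : Fin N → ℂ[X] := fun k => 1 + C (z k - ζ) * X
  let Q : ℂ[X] := ∏ k, ℓ k
  let Qk : Fin N → ℂ[X] := fun k => ∏ j ∈ Finset.univ.erase k, ℓ j
  have hQ : ∀ k, Q = ℓ k * Qk k := fun k => (Finset.mul_prod_erase _ _ (Finset.mem_univ k)).symm
  let f : ℂ[X] := C (μ - c) * Q - ∑ k, C (w k) * (X * Qk k)
  have hf : ∀ t ∈ spectrum ℂ a, f.eval t ≠ 0 := by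
    intro t ht
    -- `t = 0` corresponds to `ξ = ∞`, where the filter has the value `c`; this is where `μ ≠ c`
    -- enters.
    by_cases ht0 : t = 0
    · subst ht0
      simp [f, Q, ℓ, eval_finsetSum, eval_prod, sub_ne_zero.2 hμc]
    obtain ⟨h1, h2⟩ := hμ t ht ht0
    have hℓ : ∀ k, (ℓ k).eval t = t * (z k - (ζ - t⁻¹)) := by
      intro k
      simp only [ℓ, eval_add, eval_one, eval_mul, eval_C, eval_X]
      field_simp
      ring
    have hℓ0 : ∀ k, (ℓ k).eval t ≠ 0 := fun k => by
      rw [hℓ]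
      exact mul_ne_zero ht0 (sub_ne_zero.2 (h1 k))
    have hfe : f.eval t = Q.eval t * (μ - ratFilter c w z (ζ - t⁻¹)) := by
      simp only [f, ratFilter, eval_sub, eval_mul, eval_C, eval_finsetSum, eval_X]
      have : ∀ k, w k * (t * (Qk k).eval t) = Q.eval t * (w k * (z k - (ζ - t⁻¹))⁻¹) := by
        intro k
        have hk := sub_ne_zero.2 (h1 k)
        rw [hQ k, eval_mul, hℓ]
        calc w k * (t * (Qk k).eval t) = t * (Qk k).eval t * w k *
              ((z k - (ζ - t⁻¹)) * (z k - (ζ - t⁻¹))⁻¹) := by rw [mul_inv_cancel₀ hk]; ring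
          _ = _ := by ring
      rw [Finset.sum_congr rfl fun k _ => this k, ← Finset.mul_sum]
      ring
    rw [hfe]
    refine mul_ne_zero ?_ (sub_ne_zero.2 h2.symm)
    rw [eval_prod]
    exact Finset.prod_ne_zero_iff.2 fun k _ => hℓ0 k
  have hunit : IsUnit (aeval a f) := by
    have h0 : (0 : ℂ) ∉ spectrum ℂ (aeval a f) := by
      rw [spectrum.map_polynomial_aeval]
      rintro ⟨t, ht, h0⟩
      exact hf t ht h0
    simpa using spectrum.notMem_iff.1 h0
  obtain ⟨u, hu⟩ := hunit
  have hpp := h.idempotent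
  have hq : (1 - p) * (1 - p) = 1 - p := IsIdempotentElem.one_sub h.idempotent
  have hqR : ∀ ξ ∈ ρ, Commute (1 - p) (R ξ) := fun ξ hξ =>
    (Commute.one_left _).sub_left (h.commute ξ hξ)
  have hqa : Commute (1 - p) a := (hqR ζ hζ).mul_right (Commute.refl _)
  have hRa : ∀ ξ ∈ ρ, Commute (R ξ) a := fun ξ hξ =>
    Commute.mul_right (h.mul_comm hξ hζ) (hqR ξ hξ).symm
  have hTa : Commute (algebraMap ℂ 𝔸 μ - T) a := by
    refine (Algebra.commute_algebraMap_left μ a).sub_left ?_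
    refine ((Commute.one_left a).smul_left c).add_left ?_
    exact Commute.sum_left _ _ _ fun k _ => (hRa _ (hz k)).smul_left _
  have hqT : Commute (1 - p) (algebraMap ℂ 𝔸 μ - T) := by
    refine (Algebra.commute_algebraMap_right μ (1 - p)).sub_right ?_
    refine ((Commute.one_right _).smul_right c).add_right ?_
    exact Commute.sum_right _ _ _ fun k _ => (hqR _ (hz k)).smul_right _
  -- Denominators cleared: on the complement the inverse of `μ - T` is `Q(a) f(a)⁻¹`.
  have hkey : (algebraMap ℂ 𝔸 μ - T) * (1 - p) * aeval a Q = aeval a f * (1 - p) := by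
    have hRk : ∀ k, R (z k) * (1 - p) * aeval a (ℓ k) = a := by
      intro k
      have h1 := h.identity (z k) (hz k) ζ hζ
      have e : R (z k) * (1 - p) * a = R (z k) * R ζ * (1 - p) := by
        rw [ha, mul_assoc, ← mul_assoc (1 - p), (hqR ζ hζ).eq, mul_assoc, hq, mul_assoc]
      simp only [ℓ, map_add, map_one, map_mul, aeval_C, aeval_X]
      rw [mul_add, mul_one, ← Algebra.smul_def, mul_smul_comm, e, ← smul_mul_assoc, ← neg_sub ζ,
        neg_smul, ← h1, neg_sub, sub_mul, add_sub_cancel, ha]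
    have hRQ : ∀ k, R (z k) * (1 - p) * aeval a Q = a * aeval a (Qk k) := by
      intro k
      rw [hQ k, map_mul, ← mul_assoc, hRk]
    have hf' : aeval a f = (μ - c) • aeval a Q - ∑ k, w k • (a * aeval a (Qk k)) := by
      simp only [f, map_sub, map_mul, aeval_C, map_sum, aeval_X, Algebra.smul_def]
    have haq : a * (1 - p) = a := by rw [ha, mul_assoc, hq]
    have hcomm : ∀ g : ℂ[X], aeval a g * (1 - p) = (1 - p) * aeval a g := fun g =>
      (commute_aeval hqa g).eq.symm
    rw [hf', hT, Algebra.algebraMap_eq_smul_one]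
    simp only [sub_mul _ _ (1 - p), sub_mul _ _ (aeval a Q), add_mul, Finset.sum_mul,
      smul_mul_assoc, one_mul, hRQ]
    rw [hcomm Q, sub_smul]
    have : ∀ k, a * aeval a (Qk k) * (1 - p) = a * aeval a (Qk k) := fun k => by
      rw [mul_assoc, hcomm, ← mul_assoc, haq]
    simp only [this, sub_mul 1 p, one_mul]
    abel
  have huinv : Commute (algebraMap ℂ 𝔸 μ - T) ((u⁻¹ : 𝔸ˣ) : 𝔸) := by
    refine Commute.units_inv_right ?_
    rw [hu]
    exact commute_aeval hTa f
  have hqu : Commute (1 - p) ((u⁻¹ : 𝔸ˣ) : 𝔸) := by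
    refine Commute.units_inv_right ?_
    rw [hu]
    exact commute_aeval hqa f
  have hqQ : Commute (1 - p) (aeval a Q) := commute_aeval hqa Q
  have hTQ : Commute (algebraMap ℂ 𝔸 μ - T) (aeval a Q) := commute_aeval hTa Q
  have hpq : p * (1 - p) = 0 := by rw [mul_sub, mul_one, hpp, sub_self]
  have hqp : (1 - p) * p = 0 := by rw [sub_mul, one_mul, hpp, sub_self]
  have hx : (algebraMap ℂ 𝔸 μ - T) * ((1 - p) * aeval a Q * ((u⁻¹ : 𝔸ˣ) : 𝔸)) = 1 - p := by
    rw [← mul_assoc, ← mul_assoc, hkey, mul_assoc, hqu.eq, ← mul_assoc, ← hu, Units.mul_inv,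
      one_mul]
  refine ⟨(1 - p) * aeval a Q * ((u⁻¹ : 𝔸ˣ) : 𝔸), ?_, ?_, ?_, hx⟩
  · rw [← mul_assoc, ← mul_assoc, hpq, zero_mul, zero_mul]
  · rw [hqQ.eq, mul_assoc _ (1 - p), hqu.eq, mul_assoc, mul_assoc, hqp, mul_zero, mul_zero]
  · have : Commute (algebraMap ℂ 𝔸 μ - T) ((1 - p) * aeval a Q * ((u⁻¹ : 𝔸ˣ) : 𝔸)) :=
      (hqT.symm.mul_right hTQ).mul_right huinv
    rw [← this.eq, hx]

end RationalFilter

/-! ### Isolated spectral points -/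

/-- An isolated point of the spectrum of a normal operator is an eigenvalue. -/
theorem exists_eigenvector_of_isolated {H : Type*} [NormedAddCommGroup H] [InnerProductSpace ℂ H]
    [CompleteSpace H] {b : H →L[ℂ] H} (hb : IsStarNormal b) {t : ℂ} (ht : t ∈ spectrum ℂ b)
    (hiso : ∀ᶠ s in 𝓝[≠] t, s ∉ spectrum ℂ b) : ∃ x : H, x ≠ 0 ∧ b x = t • x := by
  classical
  -- The indicator of an isolated point is continuous on the spectrum. Its functional calculus is
  -- nonzero by spectral mapping, and `s f(s) = t f(s)` makes its range consist of eigenvectors.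
  let f : ℂ → ℂ := fun s => if s = t then 1 else 0
  have hf : ContinuousOn f (spectrum ℂ b) := by
    intro s hs
    by_cases hst : s = t
    · subst hst
      have h1 : ∀ᶠ r in 𝓝[spectrum ℂ b] s, f r = f s := by
        rw [eventually_nhdsWithin_iff] at hiso ⊢
        filter_upwards [hiso] with r hr hrs
        have : r = s := by
          by_contra hne
          exact hr hne hrs
        rw [this]
      exact tendsto_const_nhds.congr' (h1.mono fun r hr => hr.symm)
    · have h1 : ∀ᶠ r in 𝓝[spectrum ℂ b] s, f r = f s := by
        filter_upwards [(eventually_ne_nhds hst).filter_mono nhdsWithin_le_nhds] with r hr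
        simp [f, hr, hst]
      exact tendsto_const_nhds.congr' (h1.mono fun r hr => hr.symm)
  have hne : cfc f b ≠ 0 := by
    intro h0
    have h1 : (1 : ℂ) ∈ spectrum ℂ (cfc f b) := by
      rw [cfc_map_spectrum f b hb hf]
      exact ⟨t, ht, if_pos rfl⟩
    rw [h0, spectrum.mem_iff] at h1
    simp at h1
  have hmul : b * cfc f b = t • cfc f b := by
    have h1 : cfc (fun s => s * f s) b = b * cfc f b := by
      rw [cfc_mul (fun s => s) f b continuousOn_id hf, cfc_id' ℂ b hb]
    have h2 : cfc (fun s => t * f s) b = t • cfc f b := by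
      rw [cfc_const_mul t f b hf]
    rw [← h1, ← h2]
    refine cfc_congr fun s _ => ?_
    by_cases hst : s = t <;> simp [f, hst]
  obtain ⟨y, hy⟩ : ∃ y, cfc f b y ≠ 0 := by
    by_contra! h0
    exact hne (ContinuousLinearMap.ext h0)
  exact ⟨cfc f b y, hy, congrArg (fun T : H →L[ℂ] H => T y) hmul⟩

/-- Isolated spectral points of a restriction to a continuously embedded space are spectral points
of the operator on the large space. -/
theorem notMem_spectrum_of_intertwining {V H : Type*} [NormedAddCommGroup V] [NormedSpace ℂ V]
    [CompleteSpace V] [NormedAddCommGroup H] [NormedSpace ℂ H] [CompleteSpace H]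
    {i : V →L[ℂ] H} (hi : Function.Injective i) {a : V →L[ℂ] V} {b : H →L[ℂ] H}
    (hab : ∀ v, i (a v) = b (i v)) {t : ℂ} (htb : t ∉ spectrum ℂ b)
    (hiso : ∀ᶠ s in 𝓝[≠] t, s ∉ spectrum ℂ a) : t ∉ spectrum ℂ a := by
  have hev : ∀ᶠ s in 𝓝 t, s ∉ spectrum ℂ b ∧ (s ≠ t → s ∉ spectrum ℂ a) := by
    rw [eventually_nhdsWithin_iff] at hiso
    filter_upwards [hiso, (spectrum.isClosed b).isOpen_compl.mem_nhds htb] with s h1 h2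
    exact ⟨h2, h1⟩
  obtain ⟨r, hr, hball⟩ := Metric.nhds_basis_closedBall.eventually_iff.1 hev
  have hne : ∀ z ∈ Metric.sphere t r, z ≠ t := fun z hz h => by
    rw [h, Metric.mem_sphere, dist_self] at hz
    exact hr.ne hz
  have hsa : ∀ z ∈ Metric.sphere t r, z ∉ spectrum ℂ a := fun z hz =>
    (hball (Metric.sphere_subset_closedBall hz)).2 (hne z hz)
  have hinter : ∀ z, z ∉ spectrum ℂ a → z ∉ spectrum ℂ b → ∀ v,
      i (resolvent a z v) = resolvent b z (i v) := by
    intro z hza hzb v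
    have h1 : (algebraMap ℂ (V →L[ℂ] V) z - a) * resolvent a z = 1 :=
      Ring.mul_inverse_cancel _ (spectrum.notMem_iff.1 hza)
    have h2 : resolvent b z * (algebraMap ℂ (H →L[ℂ] H) z - b) = 1 :=
      Ring.inverse_mul_cancel _ (spectrum.notMem_iff.1 hzb)
    have h3 : i v = (algebraMap ℂ (H →L[ℂ] H) z - b) (i (resolvent a z v)) := by
      have h4 : (algebraMap ℂ (V →L[ℂ] V) z - a) (resolvent a z v) = v :=
        congrArg (fun T : V →L[ℂ] V => T v) h1
      conv_lhs => rw [← h4]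
      simp [Algebra.algebraMap_eq_smul_one, hab]
    rw [h3]
    exact (congrArg (fun T : H →L[ℂ] H => T (i (resolvent a z v))) h2).symm
  have hcont : ContinuousOn (fun z => (z - t)⁻¹ • resolvent a z) (Metric.sphere t r) := by
    refine ContinuousOn.smul (ContinuousOn.inv₀ (by fun_prop) fun z hz =>
      sub_ne_zero.2 (hne z hz)) ?_
    exact continuousOn_resolvent (Set.disjoint_left.2 hsa)
  have hcint := hcont.circleIntegrable hr.le
  -- Cauchy's formula as a candidate for the resolvent of `a` at `t`: on the circle both resolvents
  -- exist and are intertwined by `i`, and inside it that of `b` is holomorphic. Injectivity of `i`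
  -- then makes `G` an inverse.
  set G : V →L[ℂ] V := (2 * Real.pi * Complex.I : ℂ)⁻¹ •
    ∮ z in C(t, r), (z - t)⁻¹ • resolvent a z with hG
  have hiG : ∀ v, i (G v) = resolvent b t (i v) := by
    intro v
    let L : (V →L[ℂ] V) →L[ℂ] H := i.comp (ContinuousLinearMap.apply ℂ V v)
    have h1 : L (∮ z in C(t, r), (z - t)⁻¹ • resolvent a z) =
        ∮ z in C(t, r), (z - t)⁻¹ • resolvent b z (i v) := by
      rw [circleIntegral, ← ContinuousLinearMap.intervalIntegral_comp_comm L hcint.out,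
        circleIntegral]
      refine intervalIntegral.integral_congr fun θ _ => ?_
      have hz := circleMap_mem_sphere t hr.le θ
      simp only [map_smul]
      congr 2
      exact hinter _ (hsa _ hz) (hball (Metric.sphere_subset_closedBall hz)).1 v
    have h2 : DiffContOnCl ℂ (fun z => resolvent b z (i v)) (Metric.ball t r) := by
      refine DifferentiableOn.diffContOnCl fun z hz => ?_
      rw [closure_ball t hr.ne'] at hz
      have := (spectrum.hasDerivAt_resolvent_const_left (a := b) (k := z)
        (by simpa [spectrum] using (hball hz).1)).differentiableAt
      exact (this.clm_apply (differentiableAt_const _)).differentiableWithinAt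
    have h3 := h2.two_pi_i_inv_smul_circleIntegral_sub_inv_smul (Metric.mem_ball_self hr)
    rw [← h3, ← h1, ← map_smul]
    rfl
  refine spectrum.notMem_iff.2 (isUnit_iff_exists.2 ⟨G, ?_, ?_⟩)
  · have h1 : (algebraMap ℂ (H →L[ℂ] H) t - b) * resolvent b t = 1 :=
      Ring.mul_inverse_cancel _ (spectrum.notMem_iff.1 htb)
    ext v
    refine hi ?_
    have h2 : (algebraMap ℂ (H →L[ℂ] H) t - b) (resolvent b t (i v)) = i v :=
      congrArg (fun T : H →L[ℂ] H => T (i v)) h1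
    simpa [Algebra.algebraMap_eq_smul_one, hab, hiG] using h2
  · have h1 : resolvent b t * (algebraMap ℂ (H →L[ℂ] H) t - b) = 1 :=
      Ring.inverse_mul_cancel _ (spectrum.notMem_iff.1 htb)
    ext v
    refine hi ?_
    have h2 : resolvent b t ((algebraMap ℂ (H →L[ℂ] H) t - b) (i v)) = i v :=
      congrArg (fun T : H →L[ℂ] H => T (i v)) h1
    simpa [Algebra.algebraMap_eq_smul_one, hab, hiG] using h2

/-! ### The resolvent of a selfadjoint operator -/

section Resolvent

variable {H : Type*} [NormedAddCommGroup H] [InnerProductSpace ℂ H] {A : H →ₗ.[ℂ] H}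

theorem isResolventAt_opResolvent {ζ : ℂ} (hζ : ζ ∉ opSpectrum A) :
    IsResolventAt A ζ (opResolvent A ζ) := by
  have h : ∃ T, IsResolventAt A ζ T := not_not.1 hζ
  rw [opResolvent, dif_pos h]
  exact h.choose_spec

theorem opResolvent_identity {ζ ξ : ℂ} (hζ : ζ ∉ opSpectrum A) (hξ : ξ ∉ opSpectrum A) :
    opResolvent A ζ - opResolvent A ξ = (ξ - ζ) • (opResolvent A ζ * opResolvent A ξ) := by
  ext x
  obtain ⟨hx, h1⟩ := (isResolventAt_opResolvent hξ).1 x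
  have h2 := (isResolventAt_opResolvent hζ).2 ⟨_, hx⟩
  have h3 : x = (ζ • opResolvent A ξ x - A ⟨_, hx⟩) + (ξ - ζ) • opResolvent A ξ x := by
    conv_lhs => rw [← h1]
    rw [sub_smul]
    abel
  have h4 : opResolvent A ζ x =
      opResolvent A ξ x + (ξ - ζ) • opResolvent A ζ (opResolvent A ξ x) := by
    conv_lhs => rw [h3]
    rw [map_add, h2, map_smul]
  simp [h4]

theorem opResolvent_eigenvector {ζ l : ℂ} (hζ : ζ ∉ opSpectrum A) {x : H} (hx : x ∈ A.domain)
    (hl : A ⟨x, hx⟩ = l • x) : opResolvent A ζ x = (ζ - l)⁻¹ • x := by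
  have h := (isResolventAt_opResolvent hζ).2 ⟨x, hx⟩
  simp only [hl, ← sub_smul, map_smul] at h
  -- If `ζ = l`, the resolvent relation forces `x = 0`, so no separate hypothesis is needed.
  by_cases hne : ζ - l = 0
  · rw [hne, zero_smul] at h
    rw [← h, map_zero, smul_zero]
  · conv_rhs => rw [← h]
    rw [smul_smul, inv_mul_cancel₀ hne, one_smul]

theorem eigenvalue_mem_opSpectrum {l : ℂ} {x : A.domain} (hx : x ≠ 0)
    (hl : A x = l • (x : H)) : l ∈ opSpectrum A := by
  rintro ⟨T, hT⟩
  have h := hT.2 x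
  rw [hl, sub_self, map_zero] at h
  exact hx (Subtype.ext h.symm)

theorem inner_map_eq_of_isSelfAdjoint [CompleteSpace H] (hA : IsSelfAdjoint A) (x y : A.domain) :
    inner ℂ (A x) (y : H) = inner ℂ (x : H) (A y) := by
  have h := LinearPMap.adjoint_isFormalAdjoint (T := A) hA.dense_domain
  rw [LinearPMap.isSelfAdjoint_def.1 hA] at h
  exact h x y

theorem inner_opResolvent [CompleteSpace H] (hA : IsSelfAdjoint A) {ζ : ℂ}
    (hζ : ζ ∉ opSpectrum A) (hζ' : starRingEnd ℂ ζ ∉ opSpectrum A) (x y : H) :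
    inner ℂ (opResolvent A ζ x) y = inner ℂ x (opResolvent A (starRingEnd ℂ ζ) y) := by
  obtain ⟨hx, h1⟩ := (isResolventAt_opResolvent hζ).1 x
  obtain ⟨hy, h2⟩ := (isResolventAt_opResolvent hζ').1 y
  conv_lhs => rw [← h2]
  conv_rhs => rw [← h1]
  rw [inner_sub_left, inner_sub_right, inner_smul_left, inner_smul_right,
    inner_map_eq_of_isSelfAdjoint hA ⟨_, hx⟩ ⟨_, hy⟩]

theorem opResolvent_mem_eigenspaceOf {Λ : Finset ℝ} {ζ : ℂ} (hζ : ζ ∉ opSpectrum A) {e : H}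
    (he : e ∈ eigenspaceOf A Λ) : opResolvent A ζ e ∈ eigenspaceOf A Λ := by
  induction he using Submodule.span_induction with
  | mem x hx =>
    obtain ⟨l, hl, hx', h⟩ := hx
    rw [opResolvent_eigenvector hζ hx' h]
    exact Submodule.smul_mem _ _ (Submodule.subset_span ⟨l, hl, hx', h⟩)
  | zero => rw [map_zero]; exact Submodule.zero_mem _
  | add x y _ _ hx hy => rw [map_add]; exact Submodule.add_mem _ hx hy
  | smul c x _ hx => rw [map_smul]; exact Submodule.smul_mem _ _ hx

theorem orthProj_eq (F : Submodule ℂ H) [h : F.HasOrthogonalProjection] :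
    orthProj F = F.starProjection := by
  rw [orthProj, dif_pos h]

variable [CompleteSpace H] {Λ : Finset ℝ}

/-- Every resolvent preserves `E`. The adjoint of `R(ζ)` is `R(ζ̄)`, so the complement of `E` is
preserved too, and the projection commutes. -/
theorem isReducedPseudoResolvent_opResolvent (hA : IsSelfAdjoint A)
    (hreal : ∀ ζ ∈ opSpectrum A, starRingEnd ℂ ζ = ζ)
    [FiniteDimensional ℂ (eigenspaceOf A Λ)] :
    IsReducedPseudoResolvent (opSpectrum A)ᶜ (opResolvent A) (orthProj (eigenspaceOf A Λ)) := by
  refine ⟨fun ζ hζ ξ hξ => opResolvent_identity hζ hξ, ?_, fun ζ hζ => ?_⟩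
  · rw [orthProj_eq]
    exact Submodule.isIdempotentElem_starProjection _
  · rw [orthProj_eq]
    set E := eigenspaceOf A Λ
    have hζ' : starRingEnd ℂ ζ ∉ opSpectrum A := fun h => hζ (by
      have := hreal _ h
      rw [Complex.conj_conj] at this
      exact this ▸ h)
    ext x
    have h1 : opResolvent A ζ (E.starProjection x) ∈ E :=
      opResolvent_mem_eigenspaceOf hζ (E.starProjection_apply_mem x)
    have h2 : opResolvent A ζ (x - E.starProjection x) ∈ Eᗮ := by
      rw [Submodule.mem_orthogonal']
      intro e he
      rw [inner_opResolvent hA hζ hζ']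
      exact E.starProjection_inner_eq_zero x _ (opResolvent_mem_eigenspaceOf hζ' he)
    have h3 : opResolvent A ζ x =
        opResolvent A ζ (E.starProjection x) + opResolvent A ζ (x - E.starProjection x) := by
      rw [← map_add, add_sub_cancel]
    change E.starProjection (opResolvent A ζ x) = opResolvent A ζ (E.starProjection x)
    rw [h3, map_add, Submodule.starProjection_eq_self_iff.2 h1,
      E.starProjection_apply_eq_zero_iff.2 h2, add_zero]

theorem isStarNormal_reduced_opResolvent (hA : IsSelfAdjoint A)
    (hreal : ∀ ζ ∈ opSpectrum A, starRingEnd ℂ ζ = ζ)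
    [FiniteDimensional ℂ (eigenspaceOf A Λ)] {ζ : ℂ} (hζ : ζ ∉ opSpectrum A) :
    IsStarNormal (opResolvent A ζ * (1 - orthProj (eigenspaceOf A Λ))) := by
  have hP := isReducedPseudoResolvent_opResolvent (Λ := Λ) hA hreal
  have hζ' : starRingEnd ℂ ζ ∉ opSpectrum A := fun h => hζ (by
    have := hreal _ h
    rw [Complex.conj_conj] at this
    exact this ▸ h)
  have h1 : star (opResolvent A ζ) = opResolvent A (starRingEnd ℂ ζ) := by
    rw [ContinuousLinearMap.star_eq_adjoint]
    refine ((ContinuousLinearMap.eq_adjoint_iff _ _).2 fun x y => ?_).symm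
    rw [inner_opResolvent hA hζ' (by rwa [Complex.conj_conj]), Complex.conj_conj]
  have h2 : star (orthProj (eigenspaceOf A Λ)) = orthProj (eigenspaceOf A Λ) := by
    rw [orthProj_eq]
    exact isSelfAdjoint_starProjection _
  have hq : ∀ ξ ∉ opSpectrum A, Commute (1 - orthProj (eigenspaceOf A Λ)) (opResolvent A ξ) :=
    fun ξ hξ => (Commute.one_left _).sub_left (hP.commute ξ hξ)
  have hR : Commute (opResolvent A (starRingEnd ℂ ζ)) (opResolvent A ζ) := hP.mul_comm hζ' hζ
  refine ⟨?_⟩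
  rw [star_mul, h1, star_sub, star_one, h2]
  exact ((hq ζ hζ).mul_right (Commute.refl _)).mul_left (hR.mul_right (hq _ hζ').symm)

/-- The cluster is not seen by the resolvent on the orthogonal complement of its eigenspace. -/
theorem inv_notMem_spectrum_reduced_opResolvent (hA : IsSelfAdjoint A)
    (hreal : ∀ ζ ∈ opSpectrum A, starRingEnd ℂ ζ = ζ)
    [FiniteDimensional ℂ (eigenspaceOf A Λ)] {ζ : ℂ} (hζ : ζ ∉ opSpectrum A) {l : ℝ} (hl : l ∈ Λ)
    (hlζ : (l : ℂ) ≠ ζ) (hiso : ∀ᶠ ξ in 𝓝[≠] (l : ℂ), ξ ∉ opSpectrum A) :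
    (ζ - l)⁻¹ ∉ spectrum ℂ (opResolvent A ζ * (1 - orthProj (eigenspaceOf A Λ))) := by
  intro hmem
  have hP := isReducedPseudoResolvent_opResolvent (Λ := Λ) hA hreal
  obtain ⟨x, hx0, hx⟩ := exists_eigenvector_of_isolated
    (isStarNormal_reduced_opResolvent hA hreal hζ) hmem
    (hP.eventually_notMem_spectrum hζ hlζ hiso)
  set S := orthProj (eigenspaceOf A Λ) with hS
  have hd : ζ - l ≠ 0 := sub_ne_zero.2 hlζ.symm
  have hx1 : opResolvent A ζ (x - S x) = (ζ - l)⁻¹ • x := by simpa using hx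
  have hSS : S (S x) = S x := congrArg (fun T : H →L[ℂ] H => T x) hP.idempotent
  have hSR : S (opResolvent A ζ (x - S x)) = opResolvent A ζ (S (x - S x)) :=
    congrArg (fun T : H →L[ℂ] H => T (x - S x)) (hP.commute ζ hζ)
  -- The eigenvector is orthogonal to `E` since its eigenvalue is nonzero. It is also an eigenvector
  -- of `A` for `l`, hence lies in `E`: a contradiction.
  have hSx : S x = 0 := by
    rw [map_sub S, hSS, sub_self, map_zero, hx1, map_smul] at hSR
    exact (smul_eq_zero.1 hSR).resolve_left (inv_ne_zero hd)
  rw [hSx, sub_zero] at hx1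
  obtain ⟨hdom, h1⟩ := (isResolventAt_opResolvent hζ).1 x
  have hxR : x = (ζ - l) • opResolvent A ζ x := by
    rw [hx1, smul_smul, mul_inv_cancel₀ hd, one_smul]
  have hxdom : x ∈ A.domain := by
    rw [hxR]
    exact A.domain.smul_mem _ hdom
  have hAx : A ⟨x, hxdom⟩ = (l : ℂ) • x := by
    have h2 : (⟨x, hxdom⟩ : A.domain) = (ζ - l) • ⟨opResolvent A ζ x, hdom⟩ := Subtype.ext hxR
    have h3 : A ⟨opResolvent A ζ x, hdom⟩ = ζ • opResolvent A ζ x - x := by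
      rw [eq_sub_iff_add_eq, add_comm]
      exact (sub_eq_iff_eq_add.1 h1).symm
    rw [h2, LinearPMap.map_smul, h3, smul_sub, smul_comm, ← hxR, ← sub_smul, sub_sub_cancel]
  have hxE : x ∈ eigenspaceOf A Λ := Submodule.subset_span ⟨l, hl, hxdom, hAx⟩
  rw [hS, orthProj_eq, Submodule.starProjection_eq_self_iff.2 hxE] at hSx
  exact hx0 hSx

end Resolvent

/-! ### Restriction to the embedded space -/

section Restriction

variable {H V : Type*} [NormedAddCommGroup H] [InnerProductSpace ℂ H]
  [NormedAddCommGroup V] [InnerProductSpace ℂ V] {i : V →L[ℂ] H}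

theorem restrictV_spec {R : H →ₗ[ℂ] H} (h : ∃ T, IsRestriction i R T) (v : V) :
    i (restrictV i R v) = R (i v) := by
  rw [restrictV, dif_pos h]
  exact h.choose_spec v

/-- Bounded operators leaving the embedded space invariant restrict to bounded operators. -/
theorem exists_isRestriction [CompleteSpace V] (hi : Function.Injective i) {R : H →L[ℂ] H}
    (hR : ∀ v, R (i v) ∈ LinearMap.range (i : V →ₗ[ℂ] H)) :
    ∃ T, IsRestriction i (R : H →ₗ[ℂ] H) T := by
  let e := LinearEquiv.ofInjective (i : V →ₗ[ℂ] H) hi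
  let g : V →ₗ[ℂ] V := e.symm.toLinearMap.comp
    (LinearMap.codRestrict (LinearMap.range (i : V →ₗ[ℂ] H)) 
      ((R : H →ₗ[ℂ] H).comp (i : V →ₗ[ℂ] H)) hR)
  have hg : ∀ v, i (g v) = R (i v) := fun v =>
    congrArg Subtype.val (e.apply_symm_apply ⟨R (i v), hR v⟩)
  -- Injectivity of `i` describes the graph by an equation between continuous maps, so the closed
  -- graph theorem gives boundedness on `V`.
  have hcl : IsClosed (g.graph : Set (V × V)) := by
    have : (g.graph : Set (V × V)) = {q | i q.2 = R (i q.1)} := by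
      ext q
      simp only [SetLike.mem_coe, LinearMap.mem_graph_iff, Set.mem_ofPred_eq]
      rw [← hg]
      exact hi.eq_iff.symm
    rw [this]
    exact isClosed_eq (by fun_prop) (by fun_prop)
  exact ⟨ContinuousLinearMap.ofIsClosedGraph hcl, fun v => by simpa using hg v⟩

variable [CompleteSpace V] {A : H →ₗ.[ℂ] H} {Λ : Finset ℝ}

/-- The projection onto the cluster eigenspace as an operator on the embedded space. -/
def projV (A : H →ₗ.[ℂ] H) (Λ : Finset ℝ) (i : V →L[ℂ] H) : V →L[ℂ] V :=
  restrictV i (orthProj (eigenspaceOf A Λ) : H →ₗ[ℂ] H)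

theorem EmbeddingAssumption.opResolvent_spec (hV : EmbeddingAssumption A Λ i) {ζ : ℂ}
    (hζ : ζ ∉ opSpectrum A) (v : V) :
    i (restrictV i (opResolvent A ζ : H →ₗ[ℂ] H) v) = opResolvent A ζ (i v) :=
  restrictV_spec (exists_isRestriction hV.injective (hV.invariant ζ hζ)) v

theorem EmbeddingAssumption.projV_spec (hV : EmbeddingAssumption A Λ i)
    [FiniteDimensional ℂ (eigenspaceOf A Λ)] (v : V) :
    i (projV A Λ i v) = orthProj (eigenspaceOf A Λ) (i v) := by
  refine restrictV_spec (exists_isRestriction hV.injective fun v => hV.contains ?_) v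
  rw [orthProj_eq]
  exact Submodule.starProjection_apply_mem _ _

variable [CompleteSpace H]

theorem EmbeddingAssumption.isReducedPseudoResolvent (hV : EmbeddingAssumption A Λ i)
    (hA : IsSelfAdjoint A) (hreal : ∀ ζ ∈ opSpectrum A, starRingEnd ℂ ζ = ζ)
    [FiniteDimensional ℂ (eigenspaceOf A Λ)] :
    IsReducedPseudoResolvent (opSpectrum A)ᶜ
      (fun ζ => restrictV i (opResolvent A ζ : H →ₗ[ℂ] H)) (projV A Λ i) := by
  have hP := isReducedPseudoResolvent_opResolvent (Λ := Λ) hA hreal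
  refine ⟨fun ζ hζ ξ hξ => ?_, ?_, fun ζ hζ => ?_⟩ <;> ext v <;> refine hV.injective ?_
  · have := congrArg (fun T : H →L[ℂ] H => T (i v)) (hP.identity ζ hζ ξ hξ)
    simpa [hV.opResolvent_spec hζ, hV.opResolvent_spec hξ] using this
  · have := congrArg (fun T : H →L[ℂ] H => T (i v)) hP.idempotent
    simpa [hV.projV_spec] using this
  · have := congrArg (fun T : H →L[ℂ] H => T (i v)) (hP.commute ζ hζ)
    simpa [hV.projV_spec, hV.opResolvent_spec hζ] using this

/-- Points outside the spectrum of `A` are excluded by the explicit inverse. A cluster point gives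
an isolated `t` which is regular for the reduced resolvent on `H`, hence also on `V`. -/
theorem EmbeddingAssumption.spectrum_reduced (hV : EmbeddingAssumption A Λ i)
    (hA : IsSelfAdjoint A) (hreal : ∀ ζ ∈ opSpectrum A, starRingEnd ℂ ζ = ζ)
    [FiniteDimensional ℂ (eigenspaceOf A Λ)]
    (hΛ : ∀ l ∈ Λ, (l : ℂ) ∈ opSpectrum A)
    (hiso : ∀ l ∈ Λ, ∀ᶠ ξ in 𝓝[≠] (l : ℂ), ξ ∉ opSpectrum A) {ζ : ℂ} (hζ : ζ ∉ opSpectrum A) {t : ℂ}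
    (ht : t ∈ spectrum ℂ
      (restrictV i (opResolvent A ζ : H →ₗ[ℂ] H) * (1 - projV A Λ i))) (ht0 : t ≠ 0) :
    ζ - t⁻¹ ∈ opSpectrum A \ (Complex.ofReal '' (Λ : Set ℝ)) := by
  have hP := hV.isReducedPseudoResolvent hA hreal
  refine ⟨?_, ?_⟩
  · by_contra hn
    have := hP.isUnit hζ hn (fun h => ht0 (by simpa using h))
    rw [sub_sub_cancel, inv_inv] at this
    exact spectrum.notMem_iff.2 this ht
  · rintro ⟨l, hl, hlt⟩
    have hlζ : (l : ℂ) ≠ ζ := fun h => hζ (h ▸ hΛ l hl)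
    have htl : t = (ζ - l)⁻¹ := by rw [hlt, sub_sub_cancel, inv_inv]
    rw [htl] at ht
    refine notMem_spectrum_of_intertwining hV.injective
      (b := opResolvent A ζ * (1 - orthProj (eigenspaceOf A Λ))) (fun v => ?_)
      (inv_notMem_spectrum_reduced_opResolvent hA hreal hζ hl hlζ (hiso l hl))
      (hP.eventually_notMem_spectrum hζ hlζ (hiso l hl)) ht
    simp [hV.opResolvent_spec hζ, hV.projV_spec]

end Restriction

/-! ### The rational filter on the spectrum -/

section Filter

/-- Since the outer set is unbounded, this limit bounds `|c|` by the supremum of the filter over it.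
-/
theorem tendsto_ratFilter_atTop {N : ℕ} (c : ℂ) (w z : Fin N → ℂ) :
    Tendsto (fun x : ℝ => ratFilter c w z (x : ℂ)) atTop (𝓝 c) := by
  have h1 : ∀ k, Tendsto (fun x : ℝ => w k * (z k - (x : ℂ))⁻¹) atTop (𝓝 (w k * 0)) := by
    intro k
    refine Tendsto.const_mul _ (tendsto_inv₀_cobounded.comp ?_)
    have h2 : Tendsto (fun x : ℝ => (x : ℂ)) atTop (Bornology.cobounded ℂ) := by
      rw [← tendsto_norm_atTop_iff_cobounded]
      simpa using tendsto_abs_atTop_atTop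
    exact tendsto_const_sub_cobounded (z k) |>.comp h2
  have h3 := tendsto_finsetSum (Finset.univ : Finset (Fin N)) fun k _ => h1 k
  have h4 := h3.const_add c
  simpa [ratFilter] using h4

variable {H : Type*} [NormedAddCommGroup H] [InnerProductSpace ℂ H] {A : H →ₗ.[ℂ] H}
  {Λ : Finset ℝ} {N : ℕ} {c : ℂ} {w z : Fin N → ℂ}

theorem IsCluster.mem_opSpectrum (hΛ : IsCluster A Λ) {l : ℝ} (hl : l ∈ Λ) :
    (l : ℂ) ∈ opSpectrum A := by
  obtain ⟨x, hx, h⟩ := hΛ.eigenvalue l hl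
  exact eigenvalue_mem_opSpectrum hx h

theorem FilterAssumption.conj_eq (hF : FilterAssumption A Λ c w z) :
    ∀ ζ ∈ opSpectrum A, starRingEnd ℂ ζ = ζ := by
  obtain ⟨y, δ, γ, hδ, hγ, h1, h2, h3, h4, h5⟩ := hF
  intro ζ hζ
  by_cases h : ζ ∈ Complex.ofReal '' (Λ : Set ℝ)
  · obtain ⟨x, -, rfl⟩ := h
    exact Complex.conj_ofReal x
  · obtain ⟨x, -, rfl⟩ := h2 ⟨hζ, h⟩
    exact Complex.conj_ofReal x

/-- The rest of the spectrum lies in the union of a finite set and the closed outer set, which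
misses `l` because `γ < (1 + δ)γ`. -/
theorem FilterAssumption.isolated (hF : FilterAssumption A Λ c w z) :
    ∀ l ∈ Λ, ∀ᶠ ξ in 𝓝[≠] (l : ℂ), ξ ∉ opSpectrum A := by
  obtain ⟨y, δ, γ, hδ, hγ, h1, h2, h3, h4, h5⟩ := hF
  intro l hl
  have hc : IsClosed (Complex.ofReal '' ((Λ : Set ℝ) \ {l} ∪ outerSet y δ γ)) := by
    refine Complex.isometry_ofReal.isClosedEmbedding.isClosedMap _ (IsClosed.union ?_ ?_)
    · exact (Λ.finite_toSet.subset Set.sdiff_subset).isClosed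
    · exact isClosed_le continuous_const (by fun_prop)
  have hn : (l : ℂ) ∉ Complex.ofReal '' ((Λ : Set ℝ) \ {l} ∪ outerSet y δ γ) := by
    rintro ⟨x, hx, hxl⟩
    have hxl' : x = l := Complex.ofReal_injective hxl
    subst hxl'
    rcases hx with hx | hx
    · exact hx.2 rfl
    · have h6 : |x - y| ≤ γ := h1 hl
      have h7 : (1 + δ) * γ ≤ |x - y| := hx
      nlinarith
  rw [eventually_nhdsWithin_iff]
  filter_upwards [hc.isOpen_compl.mem_nhds hn] with ξ hξ hne hmem
  refine hξ ?_
  by_cases h : ξ ∈ Complex.ofReal '' (Λ : Set ℝ)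
  · obtain ⟨x, hx, rfl⟩ := h
    exact ⟨x, Or.inl ⟨hx, fun hxl => hne (by rw [hxl]; rfl)⟩, rfl⟩
  · obtain ⟨x, hx, rfl⟩ := h2 ⟨hmem, h⟩
    exact ⟨x, Or.inr hx, rfl⟩

theorem FilterAssumption.pole_notMem (hF : FilterAssumption A Λ c w z) (k : Fin N) :
    z k ∉ opSpectrum A := by
  obtain ⟨y, δ, γ, hδ, hγ, h1, h2, h3, h4, h5⟩ := hF
  exact fun h => h3 k (subset_closure h)

/-- The filter dominates on the cluster. -/
theorem FilterAssumption.ne (hF : FilterAssumption A Λ c w z) (hΛ : IsCluster A Λ) {l : ℝ}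
    (hl : l ∈ Λ) : ratFilter c w z l ≠ c ∧
      ∀ ξ ∈ opSpectrum A \ (Complex.ofReal '' (Λ : Set ℝ)),
        ratFilter c w z ξ ≠ ratFilter c w z l := by
  have hpole := hF.pole_notMem
  obtain ⟨y, δ, γ, hδ, hγ, h1, h2, h3, h4, h5⟩ := hF
  have hinf : filterInf c w z y γ ≤ ‖ratFilter c w z (l : ℂ)‖ₑ :=
    iInf₂_le l ⟨h1 hl, fun k h => hpole k (h ▸ hΛ.mem_opSpectrum hl)⟩
  have hlt : filterSup c w z y δ γ < filterInf c w z y γ := by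
    rw [kappaHat] at h5
    -- The cluster point itself makes the infimum finite, so the quotient bound gives a strict
    -- inequality between supremum and infimum.
    have htop : filterInf c w z y γ ≠ ⊤ := ne_top_of_le_ne_top enorm_ne_top hinf
    rwa [ENNReal.div_lt_iff (Or.inl h4) (Or.inl htop), one_mul] at h5
  have hsup : ∀ x ∈ outerSet y δ γ, (∀ k, z k ≠ x) →
      ‖ratFilter c w z (x : ℂ)‖ₑ ≤ filterSup c w z y δ γ := fun x hx hxk =>
    le_iSup₂ (f := fun (x : ℝ) (_ : x ∈ {x : ℝ | x ∈ outerSet y δ γ ∧ ∀ k, z k ≠ x}) =>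
      ‖ratFilter c w z (x : ℂ)‖ₑ) x ⟨hx, hxk⟩
  refine ⟨fun h => ?_, fun ξ hξ h => ?_⟩
  · have hc : ‖c‖ₑ ≤ filterSup c w z y δ γ := by
      refine le_of_tendsto (tendsto_ratFilter_atTop c w z).enorm ?_
      have hk : ∀ᶠ x : ℝ in atTop, ∀ k, z k ≠ x := by
        rw [eventually_all]
        intro k
        filter_upwards [eventually_gt_atTop (z k).re] with x hx h
        rw [h] at hx
        simp at hx
      filter_upwards [hk, eventually_ge_atTop (y + (1 + δ) * γ)] with x hx hx'
      refine hsup x ?_ hx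
      have : (1 + δ) * γ ≤ |x - y| := (by linarith : (1 + δ) * γ ≤ x - y).trans (le_abs_self _)
      exact this
    rw [h] at hinf
    exact (hinf.trans hc).not_gt hlt
  · obtain ⟨x, hx, rfl⟩ := h2 hξ
    have := hsup x hx fun k h => hpole k (h ▸ hξ.1)
    rw [h] at this
    exact (hinf.trans this).not_gt hlt

end Filter

/-! ### The spectral projectors of the filter and its discretization -/

theorem hasWinding_iff {θ : ℝ → ℂ} {ζ : ℂ} {n : ℤ} :
    HasWinding θ ζ n ↔ ζ ∉ curveTrace θ ∧ windingIntegral θ ζ = n := by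
  refine and_congr ⟨?_, fun h t ht h' => h ⟨t, ht, h'⟩⟩ Iff.rfl
  rintro h ⟨t, ht, rfl⟩
  exact h t ht rfl

section Winding

variable {V : Type*} [NormedAddCommGroup V] [NormedSpace ℂ V] {T : V →L[ℂ] V} {M : Set ℂ}
  {θ : ℝ → ℂ}

theorem IsSeparatingContour.mem_spectrum (hθ : IsSeparatingContour T M θ) {ζ : ℂ}
    (hζ : ζ ∈ spectrum ℂ T) :
    ζ ∉ curveTrace θ ∧ (windingIntegral θ ζ = 0 ∨ windingIntegral θ ζ = 1) := by
  by_cases hM : ζ ∈ M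
  · obtain ⟨h1, h2⟩ := hasWinding_iff.1 (hθ.encloses ζ hM)
    exact ⟨h1, Or.inr (by simpa using h2)⟩
  · obtain ⟨h1, h2⟩ := hasWinding_iff.1 (hθ.excludes ζ ⟨hζ, hM⟩)
    exact ⟨h1, Or.inl (by simpa using h2)⟩

theorem IsSeparatingContour.disjoint (hθ : IsSeparatingContour T M θ) :
    Disjoint (curveTrace θ) (spectrum ℂ T) :=
  Set.disjoint_right.2 fun _ hζ => (hθ.mem_spectrum hζ).1

/-- Stability of the spectral projector under small perturbations of the operator. -/
theorem IsSeparatingContour.eventually_perturbation [CompleteSpace V]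
    (hθ : IsSeparatingContour T M θ) {c : ℂ} (hc : c ∉ M) :
    ∀ᶠ T' in 𝓝 T, Disjoint (curveTrace θ) (spectrum ℂ T') ∧
      IsIdempotentElem (rieszIntegral θ T') ∧ ‖rieszIntegral θ T - rieszIntegral θ T'‖ < 1 ∧
      ((c ∉ curveTrace θ ∧ windingIntegral θ c = 0) ∨ c ∉ spectrum ℂ T') := by
  obtain ⟨⟨K, hK⟩, hcl, -⟩ := hθ.curve
  -- Local constancy of the winding number makes this set open. It contains the spectrum of `T`, so
  -- by upper semicontinuity it contains nearby spectra.
  let O : Set ℂ := {ζ | ζ ∉ curveTrace θ ∧ (windingIntegral θ ζ = 0 ∨ windingIntegral θ ζ = 1)}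
  have hO : IsOpen O := by
    refine isOpen_iff_mem_nhds.2 fun ζ hζ => ?_
    filter_upwards [eventually_windingIntegral_eq hK hcl hζ.1] with ξ hξ
    refine ⟨hξ.1, ?_⟩
    rw [hξ.2]
    exact hζ.2
  have hsemi : ∀ W : Set ℂ, IsOpen W → spectrum ℂ T ⊆ W →
      ∀ᶠ T' in 𝓝 T, spectrum ℂ T' ⊆ W := fun W hW hTW =>
    ((upperHemicontinuous_spectrum ℂ (V →L[ℂ] V)).upperHemicontinuousAt T W
      (hW.mem_nhdsSet.2 hTW)).mono fun T' h => subset_of_mem_nhdsSet h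
  have h1 := hsemi O hO fun ζ hζ => hθ.mem_spectrum hζ
  have h2 : ∀ᶠ T' in 𝓝 T, ‖rieszIntegral θ T - rieszIntegral θ T'‖ < 1 := by
    have := (tendsto_rieszIntegral hK hθ.disjoint).eventually
      (Metric.ball_mem_nhds (rieszIntegral θ T) one_pos)
    filter_upwards [this] with T' hT'
    rwa [dist_comm, dist_eq_norm] at hT'
  have h3 : ∀ᶠ T' in 𝓝 T,
      ((c ∉ curveTrace θ ∧ windingIntegral θ c = 0) ∨ c ∉ spectrum ℂ T') := by
    by_cases hcT : c ∈ spectrum ℂ T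
    · obtain ⟨h1, h2⟩ := hasWinding_iff.1 (hθ.excludes c ⟨hcT, hc⟩)
      exact Eventually.of_forall fun _ => Or.inl ⟨h1, by simpa using h2⟩
    · filter_upwards [hsemi {c}ᶜ isOpen_compl_singleton
        (fun ζ hζ h => hcT (by rw [Set.mem_singleton_iff] at h; exact h ▸ hζ))] with T' hT'
      exact Or.inr fun h => hT' h rfl
  filter_upwards [h1, h2, h3] with T' h1 h2 h3
  exact ⟨Set.disjoint_right.2 fun ζ hζ => (h1 hζ).1,
    isIdempotentElem_rieszIntegral hK hcl fun ζ hζ => h1 hζ, h2, h3⟩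

end Winding

/-! ### Identification and perturbation of the filter's spectral projector -/

section Projector

variable {H V : Type*} [NormedAddCommGroup H] [InnerProductSpace ℂ H]
  [NormedAddCommGroup V] [InnerProductSpace ℂ V]
  {A : H →ₗ.[ℂ] H} {Λ : Finset ℝ} {N : ℕ} {c : ℂ} {w z : Fin N → ℂ} {i : V →L[ℂ] H}
  {θ : ℝ → ℂ}

theorem filterOp_eigenvector [CompleteSpace V] (hV : EmbeddingAssumption A Λ i)
    (hz : ∀ k, z k ∉ opSpectrum A)
    {l : ℂ} {v : V} (hv : i v ∈ A.domain) (hl : A ⟨i v, hv⟩ = l • i v) :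
    filterOp A c w z i v = ratFilter c w z l • v := by
  refine hV.injective ?_
  simp [filterOp, ratFilter, hV.opResolvent_spec (hz _),
    fun k => opResolvent_eigenvector (hz k) hv hl, add_smul, Finset.sum_smul, smul_smul]

theorem resolvent_eigenvector {T : V →L[ℂ] V} {ζ μ : ℂ} (hζ : ζ ∉ spectrum ℂ T) (hne : ζ ≠ μ)
    {v : V} (hv : T v = μ • v) : resolvent T ζ v = (ζ - μ)⁻¹ • v := by
  have h1 : resolvent T ζ * (algebraMap ℂ (V →L[ℂ] V) ζ - T) = 1 :=
    Ring.inverse_mul_cancel _ (spectrum.notMem_iff.1 hζ)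
  have h2 : resolvent T ζ ((algebraMap ℂ (V →L[ℂ] V) ζ - T) v) = v :=
    congrArg (fun T : V →L[ℂ] V => T v) h1
  have h3 : (algebraMap ℂ (V →L[ℂ] V) ζ - T) v = (ζ - μ) • v := by
    simp [Algebra.algebraMap_eq_smul_one, hv, sub_smul]
  rw [h3, map_smul] at h2
  conv_rhs => rw [← h2]
  rw [smul_smul, inv_mul_cancel₀ (sub_ne_zero.2 hne), one_smul]

theorem tendsto_discreteFilterOp {I : Set ℝ} {Vh : ℝ → Submodule ℂ H} {Rh : ℝ → ℂ → H →ₗ[ℂ] H}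
    (hR : DiscretizationAssumption A z i I Vh Rh) :
    Tendsto (fun h => discreteFilterOp c w z i (Rh h)) (𝓝[I] 0) (𝓝 (filterOp A c w z i)) := by
  refine tendsto_const_nhds.add (tendsto_finsetSum _ fun k _ => Tendsto.const_smul ?_ _)
  exact tendsto_iff_norm_sub_tendsto_zero.2 (hR.limit k)

variable [CompleteSpace H] [CompleteSpace V]

/-- The spectral projector of the filter is the orthogonal projection onto the cluster
eigenspace. -/
theorem rieszIntegral_filterOp (hA : IsSelfAdjoint A) (hΛ : IsCluster A Λ)
    (hF : FilterAssumption A Λ c w z) (hV : EmbeddingAssumption A Λ i)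
    (hθ : IsSeparatingContour (filterOp A c w z i)
      ((fun l : ℝ => ratFilter c w z (l : ℂ)) '' (Λ : Set ℝ)) θ) :
    rieszIntegral θ (filterOp A c w z i) = projV A Λ i := by
  obtain ⟨⟨K, hK⟩, hcl, -⟩ := hθ.curve
  have := hΛ.finite
  have hreal := hF.conj_eq
  have hz := hF.pole_notMem
  have hP := hV.isReducedPseudoResolvent hA hreal
  have hd := hθ.disjoint
  set T := filterOp A c w z i with hT
  set p := projV A Λ i with hp
  have hnt : Nontrivial V := by
    obtain ⟨l, hl⟩ := hΛ.nonempty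
    obtain ⟨x, hx, hxl⟩ := hΛ.eigenvalue l hl
    obtain ⟨v, hv⟩ := hV.contains (Submodule.subset_span ⟨l, hl, x.2, hxl⟩)
    refine ⟨⟨v, 0, fun h => hx (Subtype.ext ?_)⟩⟩
    rw [← hv, h, map_zero]
    rfl
  -- Any nonreal number serves as base point of the reduced resolvent.
  have hI : Complex.I ∉ opSpectrum A := fun h => by
    have := hreal _ h
    rw [Complex.conj_I] at this
    have := congrArg Complex.im this
    norm_num at this
  have hpT : Commute p T := by
    refine ((Commute.one_right p).smul_right c).add_right ?_
    exact Commute.sum_right _ _ _ fun k _ => Commute.smul_right (hP.commute _ (hz k)) _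
  -- Values `r_N(l)` are regular on the complement by spectral mapping, other spectral points are
  -- not enclosed, and elsewhere the full inverse is cut down by `1 - p`.
  have hcompl : rieszIntegral θ T * (1 - p) = 0 := by
    refine rieszIntegral_mul_compl_eq_zero hK hcl hd hP.idempotent hpT fun ζ => ?_
    by_cases hM : ζ ∈ (fun l : ℝ => ratFilter c w z (l : ℂ)) '' (Λ : Set ℝ)
    · obtain ⟨l, hl, rfl⟩ := hM
      obtain ⟨hne, hne'⟩ := hF.ne hΛ hl
      refine Or.inr (hP.exists_inverse hI hz hne fun t ht ht0 => ?_)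
      have hmem := hV.spectrum_reduced hA hreal (fun l hl => hΛ.mem_opSpectrum hl) hF.isolated
        hI ht ht0
      exact ⟨fun k hk => hz k (hk ▸ hmem.1), hne' _ hmem⟩
    · by_cases hs : ζ ∈ spectrum ℂ T
      · obtain ⟨h1, h2⟩ := hasWinding_iff.1 (hθ.excludes ζ ⟨hs, hM⟩)
        exact Or.inl ⟨h1, by simpa using h2⟩
      · obtain ⟨u, hu⟩ := spectrum.notMem_iff.1 hs
        have hpu : Commute p (u : V →L[ℂ] V) := by
          rw [hu]
          exact (Algebra.commute_algebraMap_right ζ p).sub_right hpT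
        have hpu' := hpu.units_inv_right
        have hpp := hP.idempotent
        refine Or.inr ⟨((u⁻¹ : (V →L[ℂ] V)ˣ) : V →L[ℂ] V) * (1 - p), ?_, ?_, ?_, ?_⟩
        · rw [← mul_assoc, hpu'.eq, mul_assoc, mul_sub, mul_one, hpp, sub_self, mul_zero]
        · rw [mul_assoc, sub_mul, one_mul, hpp, sub_self, mul_zero]
        · rw [← hu, mul_assoc, ((Commute.one_left _).sub_left hpu).eq, ← mul_assoc, Units.inv_mul,
            one_mul]
        · rw [← hu, ← mul_assoc, Units.mul_inv, one_mul]
  -- On an eigenvector the resolvent is `(ζ - r_N(l))⁻¹`, whose contour mean is the winding number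
  -- `1`; eigenvectors span the range of `p`.
  have heig : rieszIntegral θ T * p = p := by
    let F : Submodule ℂ V := LinearMap.ker ((rieszIntegral θ T - 1 : V →L[ℂ] V) : V →ₗ[ℂ] V)
    have hE : eigenspaceOf A Λ ≤ F.map (i : V →ₗ[ℂ] H) := by
      refine Submodule.span_le.2 ?_
      rintro x ⟨l, hl, hx, hxl⟩
      obtain ⟨v, rfl⟩ := hV.contains (Submodule.subset_span ⟨l, hl, hx, hxl⟩)
      refine ⟨v, ?_, rfl⟩
      have hTv : T v = ratFilter c w z l • v := filterOp_eigenvector hV hz hx hxl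
      obtain ⟨h1, h2⟩ := hasWinding_iff.1 (hθ.encloses _ ⟨l, hl, rfl⟩)
      have h3 : rieszIntegral θ T v = v := by
        have h4 : rieszIntegral θ T v = contourMean θ (fun ζ => resolvent T ζ v) :=
          (contourMean_clm hK (ContinuousLinearMap.apply ℂ V v) (continuousOn_resolvent hd)).symm
        rw [h4, contourMean_congr (g := fun ζ => (ζ - ratFilter c w z l)⁻¹ • v) fun ζ hζ =>
          resolvent_eigenvector (Set.disjoint_left.1 hd hζ) 
            (by rintro rfl; exact h1 hζ) hTv,
          contourMean_sub_inv_smul_const hK h1, h2]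
        simp
      simp [F, h3]
    ext v
    have hpv : i (p v) ∈ eigenspaceOf A Λ := by
      rw [hp, hV.projV_spec, orthProj_eq]
      exact Submodule.starProjection_apply_mem _ _
    obtain ⟨u, hu, huv⟩ := hE hpv
    have huv' : u = p v := hV.injective huv
    subst huv'
    simpa [F, sub_eq_zero] using hu
  rw [mul_sub, mul_one, heig, sub_eq_zero] at hcompl
  exact hcompl

/-- The properties of the discrete limit space for all small discretization parameters. -/
theorem exists_forall_limitSpace (hA : IsSelfAdjoint A) (hΛ : IsCluster A Λ)
    (hF : FilterAssumption A Λ c w z) (hV : EmbeddingAssumption A Λ i)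
    {I : Set ℝ} (hI : I ⊆ Set.Ioi 0) {Vh : ℝ → Submodule ℂ H} {Rh : ℝ → ℂ → H →ₗ[ℂ] H}
    (hR : DiscretizationAssumption A z i I Vh Rh)
    (hθ : IsSeparatingContour (filterOp A c w z i)
      ((fun l : ℝ => ratFilter c w z (l : ℂ)) '' (Λ : Set ℝ)) θ) :
    ∃ h₀ > (0 : ℝ), ∀ h ∈ I, h < h₀ →
      (∀ t ∈ Set.Icc (0 : ℝ) 1, θ t ∉ spectrum ℂ (discreteFilterOp c w z i (Rh h))) ∧
      FiniteDimensional ℂ (limitSpace i (discreteFilterOp c w z i (Rh h)) θ) ∧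
      Module.finrank ℂ (limitSpace i (discreteFilterOp c w z i (Rh h)) θ) =
        Module.finrank ℂ (eigenspaceOf A Λ) ∧
      limitSpace i (discreteFilterOp c w z i (Rh h)) θ ≤ Vh h ∧
      ∀ x ∈ limitSpace i (discreteFilterOp c w z i (Rh h)) θ,
        orthProj (eigenspaceOf A Λ) x = 0 → x = 0 := by
  have := hΛ.finite
  obtain ⟨⟨K, hK⟩, hcl, -⟩ := hθ.curve
  have hc : c ∉ (fun l : ℝ => ratFilter c w z (l : ℂ)) '' (Λ : Set ℝ) := by
    rintro ⟨l, hl, h⟩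
    exact (hF.ne hΛ hl).1 h
  have hev := (tendsto_discreteFilterOp hR (c := c) (w := w)).eventually
    (hθ.eventually_perturbation hc)
  rw [rieszIntegral_filterOp hA hΛ hF hV hθ, eventually_nhdsWithin_iff,
    Metric.eventually_nhds_iff] at hev
  obtain ⟨h₀, hh₀, hev⟩ := hev
  refine ⟨h₀, hh₀, fun h hhI hhlt => ?_⟩
  have hpos : 0 < h := hI hhI
  obtain ⟨hd, hidem, hnorm, hcw⟩ := hev (y := h) (by simpa [abs_of_pos hpos] using hhlt) hhI
  set T := discreteFilterOp c w z i (Rh h) with hT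
  set q := rieszIntegral θ T with hq
  set p := projV A Λ i with hp
  have hlim : limitSpace i T θ = (LinearMap.range (q : V →ₗ[ℂ] V)).map (i : V →ₗ[ℂ] H) := rfl
  have hE : eigenspaceOf A Λ = (LinearMap.range (p : V →ₗ[ℂ] V)).map (i : V →ₗ[ℂ] H) := by
    refine le_antisymm (fun x hx => ?_) ?_
    · obtain ⟨v, rfl⟩ := hV.contains hx
      refine ⟨p v, ⟨v, rfl⟩, ?_⟩
      change i (p v) = i v
      rw [hp, hV.projV_spec, orthProj_eq]
      exact Submodule.starProjection_eq_self_iff.2 hx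
    · rintro x ⟨v, ⟨u, rfl⟩, rfl⟩
      change i (p u) ∈ _
      rw [hp, hV.projV_spec, orthProj_eq]
      exact Submodule.starProjection_apply_mem _ _
  have hpp : IsIdempotentElem p := (hV.isReducedPseudoResolvent hA hF.conj_eq).idempotent
  have hiinj : Function.Injective (i : V →ₗ[ℂ] H) := hV.injective
  let ep := Submodule.equivMapOfInjective (i : V →ₗ[ℂ] H) hiinj (LinearMap.range (p : V →ₗ[ℂ] V))
  let eq := Submodule.equivMapOfInjective (i : V →ₗ[ℂ] H) hiinj (LinearMap.range (q : V →ₗ[ℂ] V))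
  have hfp : FiniteDimensional ℂ (LinearMap.range (p : V →ₗ[ℂ] V)) := by
    have : FiniteDimensional ℂ ((LinearMap.range (p : V →ₗ[ℂ] V)).map (i : V →ₗ[ℂ] H)) :=
      hE ▸ hΛ.finite
    exact Module.Finite.equiv ep.symm
  obtain ⟨hfq, hle⟩ := finrank_range_le_of_norm_sub_lt_one hidem hnorm
  have hle' := (finrank_range_le_of_norm_sub_lt_one hpp
    (by rwa [norm_sub_rev] at hnorm : ‖q - p‖ < 1)).2
  refine ⟨fun t ht => Set.disjoint_left.1 hd (mem_curveTrace ht), ?_, ?_, ?_, ?_⟩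
  · rw [hlim]
    exact Module.Finite.equiv eq
  · rw [hlim, hE, ← eq.finrank_eq, ← ep.finrank_eq]
    exact le_antisymm hle hle'
  -- The constant term `c` alone would leave `V_h`. The factorization `q = (T - c) G` removes it,
  -- leaving only the discrete resolvents.
  · obtain ⟨G, hG⟩ := exists_rieszIntegral_eq_mul hK hd hcw
    rw [hlim]
    rintro x ⟨v, ⟨u, rfl⟩, rfl⟩
    change i (q u) ∈ Vh h
    have h1 : T - algebraMap ℂ (V →L[ℂ] V) c = ∑ k, w k • restrictV i (Rh h (z k)) := by
      rw [hT, discreteFilterOp, Algebra.algebraMap_eq_smul_one]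
      exact add_sub_cancel_left _ _
    have h2 : i (q u) = ∑ k, w k • Rh h (z k) (i (G u)) := by
      rw [hq, hG, h1]
      simp [restrictV_spec (hR.bounded_discrete h hhI _)]
    rw [h2]
    exact Submodule.sum_mem _ fun k _ => Submodule.smul_mem _ _ (hR.range h hhI k _)
  · rw [hlim]
    rintro x ⟨v, ⟨u, rfl⟩, rfl⟩ hx
    have h1 : p (q u) = 0 := hV.injective (by
      rw [hp, hV.projV_spec, map_zero]
      exact hx)
    have h2 : q (q u) = q u := congrArg (fun T : V →L[ℂ] V => T u) hidem
    -- On a vector fixed by `q` and killed by `p`, the difference `p - q` acts as `-1`.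
    have h3 : ‖q u‖ ≤ ‖p - q‖ * ‖q u‖ := by
      have := (p - q).le_opNorm (q u)
      rwa [sub_apply, h1, h2, zero_sub, norm_neg] at this
    have h4 : ‖q u‖ = 0 := by nlinarith [norm_nonneg (q u)]
    change i (q u) = 0
    rw [norm_eq_zero.1 h4, map_zero]

end Projector

/-! ### The form of a selfadjoint operator -/

section Form

variable {H : Type*} [NormedAddCommGroup H] [InnerProductSpace ℂ H] [CompleteSpace H]
  {A P B : H →ₗ.[ℂ] H} {U : H →L[ℂ] H}

theorem inner_graph_eq (hB : IsSelfAdjoint B) {x y x' y' : H} (h : (x, y) ∈ B.graph)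
    (h' : (x', y') ∈ B.graph) : inner ℂ y x' = inner ℂ x y' := by
  obtain ⟨u, hu, hu'⟩ := B.mem_graph_iff.1 h
  obtain ⟨v, hv, hv'⟩ := B.mem_graph_iff.1 h'
  simp only at hu hu' hv hv'
  rw [← hu, ← hu', ← hv, ← hv']
  exact inner_map_eq_of_isSelfAdjoint hB u v

theorem IsPosSelfAdjoint.inner_graph_nonneg (hP : IsPosSelfAdjoint P) {x y : H}
    (h : (x, y) ∈ P.graph) : 0 ≤ (inner ℂ x y).re := by
  obtain ⟨u, hu, hu'⟩ := P.mem_graph_iff.1 h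
  simp only at hu hu'
  rw [← hu, ← hu']
  exact hP.nonneg u

theorem IsPosSelfAdjoint.eq_zero_of_neg_eigenvalue (hP : IsPosSelfAdjoint P) {m : ℝ} (hm : m < 0)
    {x : H} (h : (x, (m : ℂ) • x) ∈ P.graph) : x = 0 := by
  have h1 := hP.inner_graph_nonneg h
  have h2 : 0 ≤ m * ‖x‖ ^ 2 := by
    rwa [inner_smul_right, Complex.re_ofReal_mul, ← RCLike.re_eq_complex_re,
      ← norm_sq_eq_re_inner] at h1
  have h3 : ‖x‖ ^ 2 = 0 := by nlinarith [sq_nonneg ‖x‖]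
  exact norm_eq_zero.1 (pow_eq_zero_iff two_ne_zero |>.1 h3)

/-- The domain of the square of a selfadjoint operator is not trivial. -/
theorem exists_ne_zero_mem_domain_sq [Nontrivial H] (hB : IsSelfAdjoint B) :
    ∃ w u v : H, w ≠ 0 ∧ (w, u) ∈ B.graph ∧ (u, v) ∈ B.graph := by
  -- Von Neumann's argument: projecting `(y, 0)` onto the closed graph of `B` in the Hilbert sum
  -- yields `(w, B w)` with `B² w = y - w`, so `w = 0` would force `y = 0`.
  let e := WithLp.prodContinuousLinearEquiv 2 ℂ H H
  let G : Submodule ℂ (WithLp 2 (H × H)) :=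
    B.graph.comap (e : WithLp 2 (H × H) →ₗ[ℂ] H × H)
  have hG : IsClosed (G : Set (WithLp 2 (H × H))) := hB.isClosed.preimage e.continuous
  have : CompleteSpace G := hG.completeSpace_coe
  obtain ⟨y, hy⟩ := exists_ne (0 : H)
  let Y : WithLp 2 (H × H) := WithLp.toLp 2 (y, 0)
  have hmem : G.starProjection Y ∈ G := G.starProjection_apply_mem Y
  set W := G.starProjection Y with hW
  have hWg : (W.fst, W.snd) ∈ B.graph := hmem
  have horth : ∀ x : B.domain, inner ℂ (y - W.fst) (x : H) = inner ℂ W.snd (B x) := by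
    intro x
    have hx : WithLp.toLp 2 ((x : H), B x) ∈ G := B.mem_graph x
    have h1 := G.starProjection_inner_eq_zero Y _ hx
    rw [← hW, WithLp.prod_inner_apply] at h1
    have h2 : inner ℂ (y - W.fst) (x : H) + inner ℂ (0 - W.snd) (B x) = 0 := h1
    rw [zero_sub, inner_neg_left, ← sub_eq_add_neg, sub_eq_zero] at h2
    exact h2
  have hdom : W.snd ∈ B.adjoint.domain :=
    B.mem_adjoint_domain_of_exists W.snd ⟨y - W.fst, horth⟩
  have happ := LinearPMap.adjoint_apply_eq hB.dense_domain ⟨W.snd, hdom⟩ horth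
  have hg : (W.snd, y - W.fst) ∈ B.adjoint.graph :=
    LinearPMap.mem_graph_iff _ |>.2 ⟨⟨W.snd, hdom⟩, rfl, happ⟩
  rw [LinearPMap.isSelfAdjoint_def.1 hB] at hg
  refine ⟨W.fst, W.snd, y - W.fst, fun h0 => hy ?_, hWg, hg⟩
  have hs : W.snd = 0 := by
    rw [h0] at hWg
    exact B.graph_fst_eq_zero_snd hWg rfl
  rw [hs, h0, sub_zero] at hg
  exact B.graph_fst_eq_zero_snd hg rfl

/-- If the form domain is not trivial, then `|A|`, `U_A` and `|A|^{1/2}` are the factors of the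
polar decomposition and the square root. -/
theorem isPolarDecomposition_of_formDomain_ne_bot (h : formDomain A ≠ ⊥) :
    IsPolarDecomposition A (polarU A) (absOp A) ∧ IsPosSqrt (absOp A) (absSqrt A) := by
  have hsqrt : IsPosSqrt (absOp A) (absSqrt A) := by
    have hex : ∃ B, IsPosSqrt (absOp A) B := by
      by_contra hn
      refine h ?_
      rw [formDomain, absSqrt, posSqrt, dif_neg hn]
      rfl
    rw [absSqrt, posSqrt, dif_pos hex]
    exact hex.choose_spec
  refine ⟨?_, hsqrt⟩
  have hex : ∃ P, ∃ U, IsPolarDecomposition A U P := by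
    by_contra hn
    -- The default has trivial domain, yet it would be the square of a selfadjoint operator on a
    -- nontrivial space.
    have habs : absOp A = ⊥ := by rw [absOp, dif_neg hn]
    obtain ⟨x, -, hx⟩ := Submodule.exists_mem_ne_zero_of_ne_bot h
    have : Nontrivial H := ⟨⟨x, 0, hx⟩⟩
    obtain ⟨w, u, v, hw, h1, h2⟩ := exists_ne_zero_mem_domain_sq hsqrt.pos.selfAdjoint
    have h3 := (hsqrt.sq w v).2 ⟨u, h1, h2⟩
    rw [habs] at h3
    obtain ⟨⟨q, hq⟩, hq1, -⟩ := LinearPMap.mem_graph_iff _ |>.1 h3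
    exact hw (hq1.symm.trans ((Submodule.mem_bot ℂ).1 hq))
  have hex' : ∃ U, IsPolarDecomposition A U (absOp A) := by
    rw [absOp, dif_pos hex]
    exact hex.choose_spec
  rw [polarU, dif_pos hex']
  exact hex'.choose_spec

/-- The polar decomposition on eigenvectors. -/
theorem IsPolarDecomposition.eigenvector (h : IsPolarDecomposition A U P) {e : H} {l : ℝ}
    (he : (e, (l : ℂ) • e) ∈ A.graph) :
    ∃ σ : ℝ, U e = (σ : ℂ) • e ∧ (e, ((|l| : ℝ) : ℂ) • e) ∈ P.graph ∧ σ * |l| = l := by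
  have hU : ∀ x y : H, inner ℂ (U x) y = inner ℂ x (U y) := fun x y => by
    have := ContinuousLinearMap.adjoint_inner_left U y x
    rw [← ContinuousLinearMap.star_eq_adjoint, h.selfAdjoint.star_eq] at this
    exact this
  have hU3 : ∀ x, U (U (U x)) = U x := fun x => by
    have := h.partialIsometry
    rw [h.selfAdjoint.star_eq] at this
    exact congrArg (fun T : H →L[ℂ] H => T x) this
  obtain ⟨w, hw, hlw⟩ := (h.eq_left _ _).1 he
  have hUe := (h.eq_right _ _).1 he
  -- `w - U² w` lies in the kernel of `U`, hence of `P`. It is orthogonal to `w`, a value of `P`,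
  -- and to the range of `U`, so it is orthogonal to itself.
  have hUUw : U (U w) = w := by
    have h1 : U (w - U (U w)) = 0 := by rw [map_sub, hU3, sub_self]
    have h2 := (h.ker _).1 h1
    have h3 : inner ℂ w (w - U (U w)) = 0 := by
      rw [inner_graph_eq h.pos.selfAdjoint hw h2, inner_zero_right]
    have h4 : inner ℂ (U (U w)) (w - U (U w)) = 0 := by rw [hU, h1, inner_zero_right]
    have h5 : inner ℂ (w - U (U w)) (w - U (U w)) = 0 := by rw [inner_sub_left, h3, h4, sub_zero]
    exact (sub_eq_zero.1 (inner_self_eq_zero.1 h5)).symm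
  have hPe : (e, (l : ℂ) • U e) ∈ P.graph := by
    rw [← map_smul, hlw, hUUw]
    exact hw
  -- `P e = l U e` and `P U e = l e`, so `e ± U e` are eigenvectors of `P` for `±l` whenever
  -- nonzero; positivity removes the negative eigenvalue.
  rcases lt_trichotomy l 0 with hl | hl | hl
  · have h1 : (e + U e, (l : ℂ) • (e + U e)) ∈ P.graph := by
      have := P.graph.add_mem hPe hUe
      rwa [Prod.mk_add_mk, ← smul_add, add_comm (U e)] at this
    have h2 : U e = -e :=
      (neg_eq_of_add_eq_zero_right (h.pos.eq_zero_of_neg_eigenvalue hl h1)).symm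
    refine ⟨-1, by simp [h2], ?_, by rw [abs_of_neg hl]; ring⟩
    rw [h2] at hPe
    rw [abs_of_neg hl]
    simpa using hPe
  · subst hl
    have h1 : U (U e) = 0 := (h.ker _).2 (by simpa using hUe)
    have h2 : U e = 0 := by
      have : inner ℂ (U e) (U e) = 0 := by rw [hU, h1, inner_zero_right]
      exact inner_self_eq_zero.1 this
    exact ⟨0, by simp [h2], by simpa using (h.ker e).1 h2, by simp⟩
  · have h1 : (e - U e, ((-l : ℝ) : ℂ) • (e - U e)) ∈ P.graph := by
      have := P.graph.sub_mem hPe hUe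
      rw [Prod.mk_sub_mk, ← smul_sub, ← neg_sub e, smul_neg, ← neg_smul] at this
      rw [Complex.ofReal_neg]
      exact this
    have h2 : U e = e :=
      (sub_eq_zero.1 (h.pos.eq_zero_of_neg_eigenvalue (neg_lt_zero.2 hl) h1)).symm
    refine ⟨1, by simp [h2], ?_, by rw [abs_of_pos hl]; ring⟩
    rw [h2] at hPe
    rwa [abs_of_pos hl]

/-- The square root on eigenvectors. -/
theorem IsPosSqrt.eigenvector (h : IsPosSqrt P B) {e : H} {m : ℝ} (hm : 0 ≤ m)
    (he : (e, (m : ℂ) • e) ∈ P.graph) : (e, (Real.sqrt m : ℂ) • e) ∈ B.graph := by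
  obtain ⟨w, hw, hw'⟩ := (h.sq _ _).1 he
  rcases hm.eq_or_lt with rfl | hm
  · rw [Complex.ofReal_zero, zero_smul] at hw'
    have : inner ℂ w w = 0 := by
      rw [inner_graph_eq h.pos.selfAdjoint hw hw', inner_zero_right]
    rw [inner_self_eq_zero.1 this] at hw
    simpa using hw
  · set s := Real.sqrt m with hs
    have hs0 : 0 < s := Real.sqrt_pos.2 hm
    have hss : (s : ℂ) * s = m := by
      rw [← Complex.ofReal_mul, hs, Real.mul_self_sqrt hm.le]
    have h1 := B.graph.sub_mem hw' (B.graph.smul_mem (s : ℂ) hw)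
    -- From `B² e = s² e`, the vector `(B - s) e` satisfies the eigenvalue equation of `B` for `-s <
    -- 0`, so it vanishes.
    have h2 : (w - (s : ℂ) • e, ((-s : ℝ) : ℂ) • (w - (s : ℂ) • e)) ∈ B.graph := by
      convert h1 using 1
      rw [Prod.smul_mk, Prod.mk_sub_mk, smul_sub, smul_smul, Complex.ofReal_neg, neg_smul, neg_mul,
        neg_smul, hss]
      congr 1
      abel
    have h3 := h.pos.eq_zero_of_neg_eigenvalue (neg_lt_zero.2 hs0) h2
    rw [← sub_eq_zero.1 h3]
    exact hw

theorem form_eq {x y : H} (hx : x ∈ formDomain A) (hy : y ∈ formDomain A) :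
    form A x y = inner ℂ (absSqrt A ⟨y, hy⟩) (polarU A (absSqrt A ⟨x, hx⟩)) := by
  rw [form, dif_pos ⟨hx, hy⟩]

theorem form_add_left {x x' y : H} (hx : x ∈ formDomain A) (hx' : x' ∈ formDomain A)
    (hy : y ∈ formDomain A) : form A (x + x') y = form A x y + form A x' y := by
  rw [form_eq hx hy, form_eq hx' hy, form_eq (add_mem hx hx') hy, ← inner_add_right, ← map_add,
    ← LinearPMap.map_add]
  rfl

theorem form_smul_left (c : ℂ) {x y : H} (hx : x ∈ formDomain A)
    (hy : y ∈ formDomain A) : form A (c • x) y = c * form A x y := by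
  rw [form_eq hx hy, form_eq (Submodule.smul_mem _ c hx) hy, ← inner_smul_right, ← map_smul,
    ← LinearPMap.map_smul]
  rfl

theorem conj_form (hpol : IsPolarDecomposition A (polarU A) (absOp A)) (x y : H) :
    starRingEnd ℂ (form A x y) = form A y x := by
  by_cases h : x ∈ formDomain A ∧ y ∈ formDomain A
  · rw [form_eq h.1 h.2, form_eq h.2 h.1, inner_conj_symm]
    have := ContinuousLinearMap.adjoint_inner_left (polarU A) (absSqrt A ⟨y, h.2⟩)
      (absSqrt A ⟨x, h.1⟩)
    rw [← ContinuousLinearMap.star_eq_adjoint, hpol.selfAdjoint.star_eq] at this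
    exact this
  · rw [form, dif_neg h, form, dif_neg fun h' => h h'.symm, map_zero]

theorem form_sub_sub (hpol : IsPolarDecomposition A (polarU A) (absOp A))
    {x x' y y' : H} (hx : x ∈ formDomain A) (hx' : x' ∈ formDomain A)
    (hy : y ∈ formDomain A) (hy' : y' ∈ formDomain A) :
    form A (x - x') (y - y') =
      form A x y - form A x y' - form A x' y + form A x' y' := by
  have hl : ∀ {u u' v : H}, u ∈ formDomain A → u' ∈ formDomain A → v ∈ formDomain A →
      form A (u - u') v = form A u v - form A u' v := fun {u u' v} hu hu' hv => by
    rw [sub_eq_add_neg, ← neg_one_smul ℂ u', form_add_left hu (Submodule.smul_mem _ _ hu') hv,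
      form_smul_left _ hu' hv, neg_one_mul, ← sub_eq_add_neg]
  have hr : ∀ {u v v' : H}, u ∈ formDomain A → v ∈ formDomain A → v' ∈ formDomain A →
      form A u (v - v') = form A u v - form A u v' := fun {u v v'} hu hv hv' => by
    rw [← conj_form hpol, hl hv hv' hu, map_sub, conj_form hpol, conj_form hpol]
  rw [hl hx hx' (sub_mem hy hy'), hr hx hy hy', hr hx' hy hy']
  ring

/-- `U_A` acts on `e` as a sign `σ` and `|A|^{1/2}` as `√|l|`; symmetry moves the second root off
`y`, and `σ |l| = l`. -/
theorem form_eigenvector (hpol : IsPolarDecomposition A (polarU A) (absOp A))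
    (hsq : IsPosSqrt (absOp A) (absSqrt A)) {e : H} {l : ℝ} (he : e ∈ A.domain)
    (hl : A ⟨e, he⟩ = (l : ℂ) • e) :
    e ∈ formDomain A ∧ ∀ y ∈ formDomain A, form A e y = l * inner ℂ y e := by
  have hg : (e, (l : ℂ) • e) ∈ A.graph := A.mem_graph_iff.2 ⟨⟨e, he⟩, rfl, hl⟩
  obtain ⟨σ, hσ, hP, hσl⟩ := hpol.eigenvector hg
  have hB := hsq.eigenvector (abs_nonneg l) hP
  obtain ⟨⟨u, hu⟩, hu1, hu2⟩ := (absSqrt A).mem_graph_iff.1 hB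
  simp only at hu1 hu2
  subst hu1
  refine ⟨hu, fun y hy => ?_⟩
  have hsym := inner_map_eq_of_isSelfAdjoint hsq.pos.selfAdjoint ⟨y, hy⟩ ⟨u, hu⟩
  have hm : (Real.sqrt |l| : ℂ) * Real.sqrt |l| = ((|l| : ℝ) : ℂ) := by
    rw [← Complex.ofReal_mul, Real.mul_self_sqrt (abs_nonneg l)]
  simp only [hu2] at hsym
  rw [form_eq hu hy, hu2, map_smul, hσ, inner_smul_right, inner_smul_right, hsym,
    inner_smul_right]
  conv_rhs => rw [← hσl, Complex.ofReal_mul, ← hm]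
  ring

theorem eigenspaceOf_le_formDomain (hpol : IsPolarDecomposition A (polarU A) (absOp A))
    (hsq : IsPosSqrt (absOp A) (absSqrt A)) (Λ : Finset ℝ) :
    eigenspaceOf A Λ ≤ formDomain A :=
  Submodule.span_le.2 fun _ ⟨_, _, hx, hxl⟩ => (form_eigenvector hpol hsq hx hxl).1

/-- Bounded operators representing the form on finite-dimensional spaces. -/
theorem exists_clm_inner_eq_form {F : Type*} [NormedAddCommGroup F] [InnerProductSpace ℂ F]
    [FiniteDimensional ℂ F] (g : F →ₗ[ℂ] H) (hg : ∀ x, g x ∈ formDomain A) :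
    ∃ T : F →L[ℂ] F, ∀ x y, inner ℂ y (T x) = form A (g x) (g y) := by
  have : CompleteSpace F := FiniteDimensional.complete ℂ F
  let b : F →L[ℂ] H := LinearMap.toContinuousLinearMap
    ((absSqrt A).toFun.comp (g.codRestrict (formDomain A) hg))
  refine ⟨(ContinuousLinearMap.adjoint b).comp ((polarU A).comp b), fun x y => ?_⟩
  rw [ContinuousLinearMap.comp_apply, ContinuousLinearMap.adjoint_inner_right,
    form_eq (hg x) (hg y)]
  rfl

theorem isRitzOp_ritzOp {F : Submodule ℂ H} [FiniteDimensional ℂ F] (hF : F ≤ formDomain A) :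
    IsRitzOp A F (ritzOp A F) := by
  obtain ⟨T, hT⟩ := exists_clm_inner_eq_form (A := A) F.subtype fun x => hF x.2
  have h : ∃ T, IsRitzOp A F T := ⟨T, fun x y => hT x y⟩
  rw [ritzOp, dif_pos h]
  exact h.choose_spec

end Form

/-! ### Symmetric operators on finite-dimensional spaces -/

section Symmetric

variable {F : Type*} [NormedAddCommGroup F] [InnerProductSpace ℂ F] {T : F →L[ℂ] F}

theorem mem_spectrum_of_eigenvector {μ : ℂ} {v : F} (hv : v ≠ 0) (h : T v = μ • v) :
    μ ∈ spectrum ℂ T := by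
  intro hu
  obtain ⟨u, hu⟩ := spectrum.mem_resolventSet_iff.1 hu
  have h1 : (u : F →L[ℂ] F) v = 0 := by
    simp [hu, Algebra.algebraMap_eq_smul_one, h]
  have h2 : ((u⁻¹ : (F →L[ℂ] F)ˣ) : F →L[ℂ] F) ((u : F →L[ℂ] F) v) = v :=
    congrArg (fun T : F →L[ℂ] F => T v) u.inv_mul
  rw [h1, map_zero] at h2
  exact hv h2.symm

variable [FiniteDimensional ℂ F]

theorem exists_eigenvector_of_mem_spectrum {μ : ℂ} (h : μ ∈ spectrum ℂ T) :
    ∃ v : F, v ≠ 0 ∧ T v = μ • v := by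
  have : CompleteSpace F := FiniteDimensional.complete ℂ F
  by_contra! hn
  refine h ?_
  rw [spectrum.mem_resolventSet_iff, ContinuousLinearMap.isUnit_iff_bijective]
  have hinj : Function.Injective (algebraMap ℂ (F →L[ℂ] F) μ - T) := by
    refine (injective_iff_map_eq_zero _).2 fun v hv => ?_
    by_contra hv0
    refine hn v hv0 ?_
    have : μ • v - T v = 0 := by simpa [Algebra.algebraMap_eq_smul_one] using hv
    exact (sub_eq_zero.1 this).symm
  exact ⟨hinj, LinearMap.injective_iff_surjective
    (f := ((algebraMap ℂ (F →L[ℂ] F) μ - T : F →L[ℂ] F) : F →ₗ[ℂ] F)).1 hinj⟩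

/-- Residual bound: near an approximate eigenvalue of a symmetric operator there is an
eigenvalue. -/
theorem exists_mem_spectrum_norm_sub_le (hT : (T : F →ₗ[ℂ] F).IsSymmetric) {v : F} (hv : v ≠ 0)
    {lam : ℂ} {r : ℝ} (h : ‖T v - lam • v‖ ≤ r * ‖v‖) :
    ∃ μ ∈ spectrum ℂ T, ‖lam - μ‖ ≤ r := by
  have hv0 : 0 < ‖v‖ := norm_pos_iff.2 hv
  have hr : 0 ≤ r := by
    by_contra! hr
    have := (norm_nonneg _).trans h
    nlinarith
  by_contra! hn
  set b := hT.eigenvectorBasis rfl with hb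
  have hmem : ∀ j, ((hT.eigenvalues rfl j : ℝ) : ℂ) ∈ spectrum ℂ T := fun j =>
    mem_spectrum_of_eigenvector (b.orthonormal.ne_zero j) (hT.apply_eigenvectorBasis rfl j)
  have hcoef : ∀ j, inner ℂ (b j) (T v - lam • v) =
      ((hT.eigenvalues rfl j : ℝ) - lam) * inner ℂ (b j) v := by
    intro j
    have h1 : inner ℂ (b j) (T v) = (hT.eigenvalues rfl j : ℂ) * inner ℂ (b j) v := by
      have := hT (b j) v
      rw [hT.apply_eigenvectorBasis rfl j] at this
      rw [inner_smul_left] at this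
      simpa using this.symm
    rw [inner_sub_right, h1, inner_smul_right, sub_mul]
  have hsum : ‖T v - lam • v‖ ^ 2 =
      ∑ j, ‖(hT.eigenvalues rfl j : ℂ) - lam‖ ^ 2 * ‖inner ℂ (b j) v‖ ^ 2 := by
    rw [← b.sum_sq_norm_inner_right]
    refine Finset.sum_congr rfl fun j _ => ?_
    rw [hcoef, norm_mul, mul_pow]
  -- If every eigenvalue were farther than `r` from `lam`, Parseval in an eigenbasis would make the
  -- residual too large.
  have hlt : r ^ 2 * ‖v‖ ^ 2 < ‖T v - lam • v‖ ^ 2 := by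
    rw [hsum, ← b.sum_sq_norm_inner_right v, Finset.mul_sum]
    have hgt : ∀ j, r ^ 2 < ‖(hT.eigenvalues rfl j : ℂ) - lam‖ ^ 2 := fun j => by
      have := hn _ (hmem j)
      rw [norm_sub_rev] at this
      gcongr
    obtain ⟨j, hj⟩ : ∃ j, inner ℂ (b j) v ≠ 0 := by
      by_contra! h0
      have := b.sum_sq_norm_inner_right v
      simp only [h0, norm_zero, ne_eq, OfNat.ofNat_ne_zero, not_false_eq_true, zero_pow,
        Finset.sum_const_zero] at this
      exact hv0.ne' (pow_eq_zero_iff two_ne_zero |>.1 this.symm)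
    refine Finset.sum_lt_sum (fun j _ => ?_) ⟨j, Finset.mem_univ j, ?_⟩
    · exact mul_le_mul_of_nonneg_right (hgt j).le (by positivity)
    · exact mul_lt_mul_of_pos_right (hgt j) (by positivity)
  have := pow_le_pow_left₀ (norm_nonneg _) h 2
  rw [mul_pow] at this
  exact this.not_gt hlt

end Symmetric

/-! ### The gap and the projection seminorm -/

section Gap

variable {H : Type*} [NormedAddCommGroup H] [InnerProductSpace ℂ H]

theorem infDist_eq_norm_sub_starProjection (L : Submodule ℂ H) [L.HasOrthogonalProjection]
    (x : H) : Metric.infDist x (L : Set H) = ‖x - L.starProjection x‖ := by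
  rw [L.starProjection_minimal x, Metric.infDist_eq_iInf]
  simp only [dist_eq_norm]
  rfl

theorem norm_sub_starProjection_le_of_unit {M L : Submodule ℂ H} [L.HasOrthogonalProjection]
    {x : H} (hx : x ∈ M) : ‖x - L.starProjection x‖ ≤
      (⨆ m : {m : H // m ∈ M ∧ ‖m‖ = 1}, Metric.infDist (m : H) (L : Set H)) * ‖x‖ := by
  by_cases hx0 : x = 0
  · simp [hx0]
  have hn : ‖x‖ ≠ 0 := norm_ne_zero_iff.2 hx0
  have hbdd : BddAbove (Set.range fun m : {m : H // m ∈ M ∧ ‖m‖ = 1} =>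
      Metric.infDist (m : H) (L : Set H)) := by
    refine ⟨1, ?_⟩
    rintro _ ⟨m, rfl⟩
    have := Metric.infDist_le_dist_of_mem (x := (m : H)) L.zero_mem
    rwa [dist_zero_right, m.2.2] at this
  let u : H := ((‖x‖ : ℂ)⁻¹) • x
  have hu : u ∈ M ∧ ‖u‖ = 1 := by
    refine ⟨M.smul_mem _ hx, ?_⟩
    rw [norm_smul, norm_inv, Complex.norm_real, norm_norm, inv_mul_cancel₀ hn]
  have h1 := le_ciSup hbdd ⟨u, hu⟩
  simp only at h1
  rw [infDist_eq_norm_sub_starProjection, map_smul, ← smul_sub, norm_smul, norm_inv,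
    Complex.norm_real, norm_norm, inv_mul_le_iff₀ (norm_pos_iff.2 hx0)] at h1
  rwa [mul_comm] at h1

theorem norm_sub_starProjection_le_gap_left {M L : Submodule ℂ H} [L.HasOrthogonalProjection]
    {x : H} (hx : x ∈ M) : ‖x - L.starProjection x‖ ≤ gap M L * ‖x‖ :=
  (norm_sub_starProjection_le_of_unit hx).trans
    (mul_le_mul_of_nonneg_right (le_max_left _ _) (norm_nonneg _))

theorem norm_sub_starProjection_le_gap_right {M L : Submodule ℂ H} [M.HasOrthogonalProjection]
    {x : H} (hx : x ∈ L) : ‖x - M.starProjection x‖ ≤ gap M L * ‖x‖ :=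
  (norm_sub_starProjection_le_of_unit hx).trans
    (mul_le_mul_of_nonneg_right (le_max_right _ _) (norm_nonneg _))

theorem inner_starProjection_right {M : Submodule ℂ H} [M.HasOrthogonalProjection] {x : H}
    (hx : x ∈ M) (y : H) : inner ℂ x (M.starProjection y) = inner ℂ x y := by
  rw [← M.inner_starProjection_left_eq_right, Submodule.starProjection_eq_self_iff.2 hx]

/-- Projecting to a nearby subspace and back is an operation of second order in the gap. -/
theorem norm_sub_starProjection_starProjection_le {M L : Submodule ℂ H}
    [M.HasOrthogonalProjection] [L.HasOrthogonalProjection] {g : ℝ}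
    (hg : ∀ x ∈ M, ‖x - L.starProjection x‖ ≤ g * ‖x‖) {x : H} (hx : x ∈ M) :
    ‖x - M.starProjection (L.starProjection x)‖ ≤ g ^ 2 * ‖x‖ := by
  set d := x - M.starProjection (L.starProjection x) with hd
  have hdM : d ∈ M := M.sub_mem hx (M.starProjection_apply_mem _)
  -- The inner `M`-projection is dropped because `d ∈ M`, and `x - L x` is orthogonal to `L`. Each
  -- remaining factor contributes one power of `g`.
  have h1 : inner ℂ d d = inner ℂ (d - L.starProjection d) (x - L.starProjection x) := by
    have h2 : inner ℂ (L.starProjection d) (x - L.starProjection x) = 0 :=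
      inner_eq_zero_symm.1 (L.starProjection_inner_eq_zero x _ (L.starProjection_apply_mem d))
    have h3 : inner ℂ d d = inner ℂ d (x - L.starProjection x) := by
      conv_lhs => rw [hd, inner_sub_right, ← hd]
      rw [inner_starProjection_right hdM, inner_sub_right]
    rw [h3, inner_sub_left d, h2, sub_zero]
  have h2 : ‖d‖ * ‖d‖ ≤ (g * ‖d‖) * (g * ‖x‖) := by
    have h3 : ‖d‖ * ‖d‖ = ‖inner ℂ d d‖ := by
      rw [inner_self_eq_norm_sq_to_K]
      simp [pow_two]
    rw [h3, h1]
    refine (norm_inner_le_norm _ _).trans ?_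
    exact mul_le_mul (hg d hdM) (hg x hx) (norm_nonneg _) ((norm_nonneg _).trans (hg d hdM))
  rcases (norm_nonneg d).eq_or_lt with h0 | h0
  · rw [← h0]
    positivity
  · nlinarith

end Gap

/-! ### Ritz operators and the eigenvalue estimate -/

section Ritz

variable {H : Type*} [NormedAddCommGroup H] [InnerProductSpace ℂ H] [CompleteSpace H]
  {A : H →ₗ.[ℂ] H} {Λ : Finset ℝ}

theorem isSymmetric_of_inner_eq_form (hpol : IsPolarDecomposition A (polarU A) (absOp A))
    {F : Type*} [NormedAddCommGroup F] [InnerProductSpace ℂ F] {g : F → H} {T : F →L[ℂ] F}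
    (hT : ∀ x y, inner ℂ y (T x) = form A (g x) (g y)) : (T : F →ₗ[ℂ] F).IsSymmetric := by
  intro x y
  change inner ℂ (T x) y = inner ℂ x (T y)
  rw [← inner_conj_symm, hT, hT, conj_form hpol]

/-- The form on a finite-dimensional space is bounded by the square of the supremum in
`projSeminorm`. -/
theorem norm_le_projSeminorm_sq (hpol : IsPolarDecomposition A (polarU A) (absOp A))
    {E F : Submodule ℂ H} [E.HasOrthogonalProjection] [F.HasOrthogonalProjection]
    {T : F →L[ℂ] F} (hT : ∀ x y : F, inner ℂ y (T x) =
      form A (E.starProjection x - x) (E.starProjection y - y)) :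
    ‖T‖ ≤ projSeminorm A E F ^ 2 := by
  have hsymm := isSymmetric_of_inner_eq_form hpol
    (g := fun x : F => E.starProjection x - x) hT
  have hterm : ∀ v : H, ∀ hv : v ∈ F, formSeminorm A
      ((orthProj E - ContinuousLinearMap.id ℂ H) (orthProj F v)) =
        Real.sqrt ‖inner ℂ (⟨v, hv⟩ : F) (T ⟨v, hv⟩)‖ := by
    intro v hv
    rw [hT, orthProj_eq, orthProj_eq, Submodule.starProjection_eq_self_iff.2 hv]
    rfl
  -- A real supremum is meaningful only if bounded; the operator `T` supplies the bound.
  have hbdd : BddAbove (Set.range fun v : {v : H // v ∈ F ∧ v ≠ 0} => formSeminorm A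
      ((orthProj E - ContinuousLinearMap.id ℂ H) (orthProj F (v : H))) / ‖(v : H)‖) := by
    refine ⟨Real.sqrt ‖T‖, ?_⟩
    rintro _ ⟨⟨v, hv, hv0⟩, rfl⟩
    simp only
    rw [hterm v hv, div_le_iff₀ (norm_pos_iff.2 hv0)]
    rw [← Real.sqrt_sq (norm_nonneg v), ← Real.sqrt_mul (norm_nonneg T)]
    refine Real.sqrt_le_sqrt ?_
    calc ‖inner ℂ (⟨v, hv⟩ : F) (T ⟨v, hv⟩)‖ ≤ ‖v‖ * (‖T‖ * ‖v‖) :=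
          (norm_inner_le_norm _ _).trans (mul_le_mul_of_nonneg_left (T.le_opNorm _)
            (norm_nonneg _))
      _ = ‖T‖ * ‖v‖ ^ 2 := by ring
  have hquad : ∀ v : F, ‖inner ℂ v (T v)‖ ≤ projSeminorm A E F ^ 2 * ‖v‖ ^ 2 := by
    intro v
    by_cases hv0 : v = 0
    · simp [hv0]
    have hv0' : (v : H) ≠ 0 := fun h => hv0 (Subtype.ext h)
    have h1 := le_ciSup hbdd ⟨(v : H), v.2, hv0'⟩
    simp only at h1
    rw [hterm v v.2, div_le_iff₀ (norm_pos_iff.2 hv0')] at h1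
    have h2 := pow_le_pow_left₀ (Real.sqrt_nonneg _) h1 2
    rw [Real.sq_sqrt (norm_nonneg _), mul_pow] at h2
    exact h2
  -- For a symmetric operator the diagonal values alone determine the norm, so no polarization
  -- constant appears.
  rw [ContinuousLinearMap.norm_eq_iSup_rayleighQuotient T hsymm]
  refine ciSup_le fun v => ?_
  by_cases hv0 : v = 0
  · rw [hv0, ContinuousLinearMap.rayleighQuotient_apply_zero, abs_zero]
    positivity
  have hv2 : 0 < ‖v‖ ^ 2 := by
    have := norm_pos_iff.2 hv0
    positivity
  rw [ContinuousLinearMap.rayleighQuotient, abs_div, abs_of_pos hv2, div_le_iff₀ hv2,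
    ContinuousLinearMap.reApplyInnerSelf_apply]
  refine (RCLike.abs_re_le_norm _).trans ?_
  rw [norm_inner_symm]
  exact hquad v

variable [FiniteDimensional ℂ (eigenspaceOf A Λ)]

theorem ritzOp_eigenvector (hpol : IsPolarDecomposition A (polarU A) (absOp A))
    (hsq : IsPosSqrt (absOp A) (absSqrt A)) {e : eigenspaceOf A Λ} {l : ℝ}
    (he : (e : H) ∈ A.domain) (hl : A ⟨e, he⟩ = (l : ℂ) • (e : H)) :
    ritzOp A (eigenspaceOf A Λ) e = (l : ℂ) • e := by
  have hD := eigenspaceOf_le_formDomain hpol hsq Λ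
  refine ext_inner_left ℂ fun y => ?_
  have h1 := isRitzOp_ritzOp hD e y
  rw [(form_eigenvector hpol hsq he hl).2 _ (hD y.2)] at h1
  rw [inner_smul_right]
  exact h1

/-- The second argument ranges over the whole form domain, not only `E`. For `y` orthogonal to `E`
this makes the cross terms vanish. -/
theorem form_eigenspaceOf (hpol : IsPolarDecomposition A (polarU A) (absOp A))
    (hsq : IsPosSqrt (absOp A) (absSqrt A)) (e : eigenspaceOf A Λ) {y : H}
    (hy : y ∈ formDomain A) :
    form A e y = inner ℂ y (ritzOp A (eigenspaceOf A Λ) e : H) := by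
  have hD := eigenspaceOf_le_formDomain hpol hsq Λ
  obtain ⟨e, he⟩ := e
  induction he using Submodule.span_induction with
  | mem x hx =>
    obtain ⟨l, hl, hx', h⟩ := id hx
    rw [(form_eigenvector hpol hsq hx' h).2 y hy,
      ritzOp_eigenvector hpol hsq (e := ⟨x, Submodule.subset_span hx⟩) hx' h, Submodule.coe_smul,
      inner_smul_right]
  | zero =>
    have h0 : (⟨0, Submodule.zero_mem _⟩ : eigenspaceOf A Λ) = 0 := rfl
    have h1 := form_smul_left (0 : ℂ) (Submodule.zero_mem (formDomain A)) hy
    rw [zero_smul, zero_mul] at h1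
    rw [h0, map_zero, Submodule.coe_zero, inner_zero_right, h1]
  | add x x' hx hx' h h' =>
    have h0 : (⟨x + x', Submodule.add_mem _ hx hx'⟩ : eigenspaceOf A Λ) = ⟨x, hx⟩ + ⟨x', hx'⟩ := rfl
    rw [h0, map_add, Submodule.coe_add, Submodule.coe_add, inner_add_right, ← h, ← h',
      form_add_left (hD hx) (hD hx') hy]
  | smul c x hx h =>
    have h0 : (⟨c • x, Submodule.smul_mem _ c hx⟩ : eigenspaceOf A Λ) = c • ⟨x, hx⟩ := rfl
    rw [h0, map_smul, Submodule.coe_smul, Submodule.coe_smul, inner_smul_right, ← h,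
      form_smul_left c (hD hx) hy]

/-- An eigenvector for a value outside `Λ` would be orthogonal to all the eigenvectors spanning `E`,
hence to itself. -/
theorem mem_of_mem_spectrum_ritzOp (hpol : IsPolarDecomposition A (polarU A) (absOp A))
    (hsq : IsPosSqrt (absOp A) (absSqrt A)) {μ : ℂ}
    (hμ : μ ∈ spectrum ℂ (ritzOp A (eigenspaceOf A Λ))) :
    μ ∈ Complex.ofReal '' (Λ : Set ℝ) := by
  obtain ⟨v, hv, h⟩ := exists_eigenvector_of_mem_spectrum hμ
  have hD := eigenspaceOf_le_formDomain hpol hsq Λ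
  have hsymm := isSymmetric_of_inner_eq_form hpol
    (g := ((↑) : eigenspaceOf A Λ → H)) fun x y => isRitzOp_ritzOp hD x y
  by_contra hn
  have horth : (v : H) ∈ (eigenspaceOf A Λ)ᗮ := by
    rw [Submodule.mem_orthogonal]
    intro u hu
    induction hu using Submodule.span_induction with
    | mem x hx =>
      obtain ⟨l, hl, hx', hxl⟩ := id hx
      have h1 := hsymm ⟨x, Submodule.subset_span hx⟩ v
      simp only [ContinuousLinearMap.coe_coe] at h1
      rw [ritzOp_eigenvector hpol hsq (e := ⟨x, Submodule.subset_span hx⟩) hx' hxl, h,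
        inner_smul_left, inner_smul_right, Complex.conj_ofReal] at h1
      have h2 : ((l : ℂ) - μ) * inner ℂ x (v : H) = 0 := by
        rw [sub_mul, sub_eq_zero]
        exact h1
      refine (mul_eq_zero.1 h2).resolve_left fun h3 => hn ⟨l, hl, sub_eq_zero.1 h3⟩
    | zero => exact inner_zero_left _
    | add x y _ _ hx hy => rw [inner_add_left, hx, hy, add_zero]
    | smul c x _ hx => rw [inner_smul_left, hx, mul_zero]
  have h0 : inner ℂ (v : H) (v : H) = 0 := (Submodule.mem_orthogonal _ _).1 horth v v.2
  exact hv (Subtype.ext (inner_self_eq_zero.1 h0))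

/-- The Ritz values on a subspace close to the cluster eigenspace approximate the cluster. -/
theorem hausdorffDist_ritzValues_le (hpol : IsPolarDecomposition A (polarU A) (absOp A))
    (hsq : IsPosSqrt (absOp A) (absSqrt A)) (hΛ : IsCluster A Λ) {F : Submodule ℂ H}
    [FiniteDimensional ℂ F] (hF : F ≤ formDomain A)
    (hdim : Module.finrank ℂ F = Module.finrank ℂ (eigenspaceOf A Λ))
    (hinj : ∀ x ∈ F, orthProj (eigenspaceOf A Λ) x = 0 → x = 0) :
    Metric.hausdorffDist (Complex.ofReal '' (Λ : Set ℝ)) (ritzValues A F) ≤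
      projSeminorm A (eigenspaceOf A Λ) F ^ 2 +
        ‖ritzOp A (eigenspaceOf A Λ)‖ * gap (eigenspaceOf A Λ) F ^ 2 := by
  have hD := eigenspaceOf_le_formDomain hpol hsq Λ
  set E := eigenspaceOf A Λ with hE
  set S := E.starProjection with hS
  set Q := F.starProjection with hQ
  rw [orthProj_eq] at hinj
  set a := ritzOp A F with ha
  set aE := ritzOp A E with haE
  have haR : IsRitzOp A F a := isRitzOp_ritzOp hF
  have hSE : ∀ x, S x ∈ E := E.starProjection_apply_mem
  obtain ⟨K, hK⟩ := exists_clm_inner_eq_form (A := A) (F := F)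
    (((S - 1 : H →L[ℂ] H) : H →ₗ[ℂ] H).comp F.subtype)
    fun x => (formDomain A).sub_mem (hD (hSE x)) (hF x.2)
  replace hK : ∀ x y : F, inner ℂ y (K x) = form A (S x - x) (S y - y) := hK
  have hKn : ‖K‖ ≤ projSeminorm A E F ^ 2 := norm_le_projSeminorm_sq hpol hK
  set η := projSeminorm A E F ^ 2 with hη
  set g := gap E F with hg
  have hKv : ∀ v : F, ‖K v‖ ≤ η * ‖v‖ := fun v =>
    (K.le_opNorm v).trans (mul_le_mul_of_nonneg_right hKn (norm_nonneg _))
  have hgE : ∀ x ∈ E, ‖x - S (Q x)‖ ≤ g ^ 2 * ‖x‖ := fun x hx =>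
    norm_sub_starProjection_starProjection_le
      (fun x hx => norm_sub_starProjection_le_gap_left hx) hx
  have hgF : ∀ x ∈ F, ‖x - Q (S x)‖ ≤ g ^ 2 * ‖x‖ := fun x hx =>
    norm_sub_starProjection_starProjection_le
      (fun x hx => norm_sub_starProjection_le_gap_right hx) hx
  have hasymm := isSymmetric_of_inner_eq_form hpol (g := ((↑) : F → H)) fun x y => haR x y
  have hKsymm := isSymmetric_of_inner_eq_form hpol (g := fun x : F => S x - x) hK
  have hEsymm := isSymmetric_of_inner_eq_form hpol
    (g := ((↑) : E → H)) fun x y => isRitzOp_ritzOp hD x y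
  have hcross : ∀ e : E, ∀ y ∈ F, form A e (S y - y) = 0 := by
    intro e y hy
    rw [form_eigenspaceOf hpol hsq e ((formDomain A).sub_mem (hD (hSE y)) (hF hy)), ← neg_sub,
      inner_neg_left, E.starProjection_inner_eq_zero y _ (Subtype.coe_prop _), neg_zero]
  -- Expand the form with `v = S v - (S v - v)` in both arguments; the mixed terms vanish by
  -- `hcross` and symmetry.
  have hdecomp : ∀ v : F, (a v : H) = Q (aE ⟨S v, hSE v⟩ : H) + K v := by
    intro v
    have h1 : a v = ⟨Q (aE ⟨S v, hSE v⟩ : H), F.starProjection_apply_mem _⟩ + K v := by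
      refine ext_inner_left ℂ fun y => ?_
      rw [inner_add_right, hK]
      have h2 : inner ℂ y (⟨Q (aE ⟨S v, hSE v⟩ : H), F.starProjection_apply_mem _⟩ : F) =
          form A (S v) (S y) := by
        rw [Submodule.coe_inner, inner_starProjection_right y.2,
          form_eigenspaceOf hpol hsq ⟨S v, hSE v⟩ (hD (hSE y)),
          E.inner_starProjection_left_eq_right,
          Submodule.starProjection_eq_self_iff.2 (Subtype.coe_prop _)]
      have h3 : inner ℂ y (a v) = form A (v : H) (y : H) := haR v y
      have h4 : form A (v : H) (y : H) = form A (S v - (S v - v)) (S y - (S y - y)) := by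
        rw [sub_sub_cancel, sub_sub_cancel]
      have h5 : form A (S v - v) (S y) = 0 := by
        rw [← conj_form hpol, hcross ⟨S y, hSE y⟩ v v.2, map_zero]
      rw [h2, h3, h4, form_sub_sub hpol (hD (hSE v))
        ((formDomain A).sub_mem (hD (hSE v)) (hF v.2)) (hD (hSE y))
        ((formDomain A).sub_mem (hD (hSE y)) (hF y.2)), hcross ⟨S v, hSE v⟩ y y.2, h5, sub_zero,
        sub_zero]
    rw [h1]
    rfl
  have hη0 : 0 ≤ η := sq_nonneg _
  refine Metric.hausdorffDist_le_of_mem_dist (by positivity) ?_ ?_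
  · rintro _ ⟨l, hl, rfl⟩
    obtain ⟨x, hx0, hxl⟩ := hΛ.eigenvalue l hl
    have hxE : (x : H) ∈ E := Submodule.subset_span ⟨l, hl, x.2, hxl⟩
    have hax : aE ⟨x, hxE⟩ = (l : ℂ) • ⟨x, hxE⟩ :=
      ritzOp_eigenvector hpol hsq (e := ⟨x, hxE⟩) x.2 hxl
    have hx0' : (⟨x, hxE⟩ : E) ≠ 0 := fun h =>
      hx0 (Subtype.ext (congrArg (Subtype.val : E → H) h))
    have hln : ‖(l : ℂ)‖ ≤ ‖aE‖ := by
      have h1 := aE.le_opNorm ⟨x, hxE⟩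
      rw [hax, norm_smul] at h1
      exact le_of_mul_le_mul_right h1 (norm_pos_iff.2 hx0')
    let s : F →ₗ[ℂ] E := ((S : H →ₗ[ℂ] H).comp F.subtype).codRestrict E fun v => hSE v
    have hs : Function.Injective s := by
      refine (injective_iff_map_eq_zero s).2 fun v hv => Subtype.ext (hinj v v.2 ?_)
      exact congrArg Subtype.val hv
    have hsurj : Function.Surjective s :=
      (LinearMap.injective_iff_surjective_of_finrank_eq_finrank hdim).1 hs
    -- Lifting the eigenvector through `S`, rather than projecting it to `F`, makes the residual
    -- exactly `K v - l (v - Q S v)`.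
    obtain ⟨v, hv⟩ := hsurj ⟨x, hxE⟩
    have hv0 : v ≠ 0 := by
      rintro rfl
      rw [map_zero] at hv
      exact hx0' hv.symm
    have hSv : (⟨S v, hSE v⟩ : E) = ⟨x, hxE⟩ := hv
    have hSv' : S v = x := congrArg Subtype.val hSv
    have hres : ‖a v - (l : ℂ) • v‖ ≤ (η + ‖aE‖ * g ^ 2) * ‖v‖ := by
      have h1 : ((a v - (l : ℂ) • v : F) : H) = K v - (l : ℂ) • ((v : H) - Q (S v)) := by
        rw [Submodule.coe_sub, hdecomp, hSv, hax, Submodule.coe_smul, Submodule.coe_smul, map_smul,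
          hSv', smul_sub]
        abel
      rw [← Submodule.norm_coe, h1]
      refine (norm_sub_le _ _).trans ?_
      rw [norm_smul]
      have h2 := hKv v
      have h3 := mul_le_mul hln (hgF v v.2) (norm_nonneg _) aE.opNorm_nonneg
      rw [Submodule.norm_coe] at h3
      rw [Submodule.norm_coe (K v)]
      linarith
    obtain ⟨μ, hμ, h⟩ := exists_mem_spectrum_norm_sub_le hasymm hv0 hres
    exact ⟨μ, hμ, by rwa [dist_eq_norm]⟩
  · intro μ hμ
    obtain ⟨v, hv0, hv⟩ := exists_eigenvector_of_mem_spectrum hμ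
    have hTsymm : ((a - K : F →L[ℂ] F) : F →ₗ[ℂ] F).IsSymmetric := hasymm.sub hKsymm
    have hres : ‖(a - K) v - μ • v‖ ≤ η * ‖v‖ := by
      have : (a - K) v - μ • v = -K v := by
        rw [sub_apply, hv]
        abel
      rw [this, norm_neg]
      exact hKv v
    -- The step through the spectrum of `a - K = Q A_E S` separates the two errors: removing `K`
    -- costs `η`, and passing from `Q A_E S` to `A_E` costs `‖A_E‖ g²`.
    obtain ⟨ν, hν, hμν⟩ := exists_mem_spectrum_norm_sub_le hTsymm hv0 hres
    obtain ⟨u, hu0, hu⟩ := exists_eigenvector_of_mem_spectrum hν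
    set e : E := ⟨S u, hSE u⟩ with he
    have he0 : e ≠ 0 := fun h => hu0 (Subtype.ext (hinj u u.2 (congrArg Subtype.val h)))
    have hQu : Q (aE e : H) = ν • (u : H) := by
      have h1 := congrArg Subtype.val hu
      rw [sub_apply, Submodule.coe_sub, hdecomp, add_sub_cancel_right] at h1
      exact h1
    -- Applying `S` to `Q A_E e = ν u` turns the residual into `(I - S Q) A_E e`, which is of second
    -- order in the gap.
    have hres2 : ‖aE e - ν • e‖ ≤ ‖aE‖ * g ^ 2 * ‖e‖ := by
      have h1 : ((aE e - ν • e : E) : H) = (aE e : H) - S (Q (aE e : H)) := by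
        rw [hQu, map_smul]
        rfl
      rw [← Submodule.norm_coe, h1]
      refine (hgE _ (aE e).2).trans ?_
      rw [Submodule.norm_coe]
      have := mul_le_mul_of_nonneg_left (aE.le_opNorm e) (sq_nonneg g)
      linarith
    obtain ⟨l, hl, hνl⟩ := exists_mem_spectrum_norm_sub_le hEsymm he0 hres2
    refine ⟨l, mem_of_mem_spectrum_ritzOp hpol hsq hl, ?_⟩
    rw [dist_eq_norm]
    have := norm_sub_le_norm_sub_add_norm_sub μ ν l
    linarith

end Ritz

end FilteredSubspace

end

theorem mainTheorem3 {H V : Type*}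
    [NormedAddCommGroup H] [InnerProductSpace ℂ H] [CompleteSpace H]
    [NormedAddCommGroup V] [InnerProductSpace ℂ V] [CompleteSpace V]
    (A : H →ₗ.[ℂ] H) (hA : IsSelfAdjoint A)
    (Λ : Finset ℝ) (hΛ : FilteredSubspace.IsCluster A Λ)
    (N : ℕ) (c : ℂ) (w z : Fin N → ℂ)
    (hFilter : FilteredSubspace.FilterAssumption A Λ c w z)
    (i : V →L[ℂ] H) (hV : FilteredSubspace.EmbeddingAssumption A Λ i)
    (I : Set ℝ) (hI : I ⊆ Set.Ioi 0)
    (Vh : ℝ → Submodule ℂ H) (Rh : ℝ → ℂ → H →ₗ[ℂ] H)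
    (hR : FilteredSubspace.DiscretizationAssumption A z i I Vh Rh)
    (hdom : ∀ h ∈ I, Vh h ≤ FilteredSubspace.formDomain A)
    (θ : ℝ → ℂ)
    (hθ : FilteredSubspace.IsSeparatingContour (FilteredSubspace.filterOp A c w z i)
      ((fun l : ℝ => FilteredSubspace.ratFilter c w z (l : ℂ)) '' (Λ : Set ℝ)) θ) :
    ∃ C₀ > (0 : ℝ), ∃ h₀ > (0 : ℝ), ∀ h ∈ I, h < h₀ →
      let E := FilteredSubspace.eigenspaceOf A Λ
      let Sh := FilteredSubspace.discreteFilterOp c w z i (Rh h)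
      let Eh := FilteredSubspace.limitSpace i Sh θ
      (∀ t ∈ Set.Icc (0 : ℝ) 1, θ t ∉ spectrum ℂ Sh) ∧
      Module.finrank ℂ Eh = Module.finrank ℂ E ∧
      Eh ≤ FilteredSubspace.formDomain A ∧
      Metric.hausdorffDist (Complex.ofReal '' (Λ : Set ℝ)) (FilteredSubspace.ritzValues A Eh) ≤
        FilteredSubspace.projSeminorm A E Eh ^ 2 +
          C₀ * ‖FilteredSubspace.ritzOp A E‖ * FilteredSubspace.gap E Eh ^ 2 := by
  have hfin := hΛ.finite
  obtain ⟨h₀, hh₀, key⟩ :=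
    FilteredSubspace.exists_forall_limitSpace hA hΛ hFilter hV hI hR hθ
  refine ⟨1, one_pos, h₀, hh₀, fun h hhI hlt => ?_⟩
  obtain ⟨hspec, hEhfin, hdim, hle, hinj⟩ := key h hhI hlt
  have hEhdom := hle.trans (hdom h hhI)
  refine ⟨hspec, hdim, hEhdom, ?_⟩
  -- `E_h` has the dimension of `E`, at least one, and lies in the form domain; this certifies the
  -- chosen polar decomposition and square root.
  have hne : FilteredSubspace.formDomain A ≠ ⊥ := by
    intro hbot
    rw [hbot, le_bot_iff] at hEhdom
    rw [hEhdom, finrank_bot] at hdim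
    obtain ⟨l, hl⟩ := hΛ.nonempty
    obtain ⟨x, hx, hxl⟩ := hΛ.eigenvalue l hl
    have hxE : (x : H) ∈ FilteredSubspace.eigenspaceOf A Λ :=
      Submodule.subset_span ⟨l, hl, x.2, hxl⟩
    rw [Submodule.finrank_eq_zero.1 hdim.symm, Submodule.mem_bot] at hxE
    exact hx (Subtype.ext hxE)
  obtain ⟨hpol, hsq⟩ := FilteredSubspace.isPolarDecomposition_of_formDomain_ne_bot hne
  rw [one_mul]
  exact FilteredSubspace.hausdorffDist_ritzValues_le hpol hsq hΛ hEhdom hdim hinj
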